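/- Conventions. All alphabets are finite. A transducer over an alphabet $\Gamma$ is a finite automaton (finitely many states, one initial state, a set of final states) whose transitions are labelled by pairs in $(\Gamma\cup\{\varepsilon\})\times(\Gamma\cup\{\varepsilon\})$; a run with successive labels $(x_1,y_1),\dots,(x_n,y_n)$ is associated to the pair $(x_1\cdots x_n,\,y_1\cdots y_n)$, and the relation on $\Gamma^*$ accepted by the transducer is the set of pairs associated to the runs from the initial state to a final state. A rational graph labelled by $\Sigma$ with vertices in $\Gamma^*$ is given by a family $(T_a)_{a\in\Sigma}$ of transducers over $\Gamma$: for $u,v\in\Gamma^*$ and $a\in\Sigma$ there is an edge labelled $a$ from $u$ to $v$ if and only if $(u,v)$ is accepted by $T_a$. It is of finite out-degree if every vertex is the source of only finitely many edges. For a rational graph $G$ and sets $I,F\subseteq\Gamma^*$, the path language $L(G,I,F)\subseteq\Sigma^*$ is the set of labels of the (possibly empty) paths of $G$ from a vertex in $I$ to a vertex in $F$. A language is context-sensitive if it is generated by a context-sensitive grammar, that is, a grammar with finitely many rules, all of the form $\alpha A\beta\to\alpha\gamma\beta$ with $A$ a nonterminal, $\alpha,\beta,\gamma$ words of terminals and nonterminals,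 and $\gamma\neq\varepsilon$; thus context-sensitive languages do not contain the empty word $\varepsilon$. **Theorem.** Let $\Sigma$ be a finite alphabet and $L\subseteq\Sigma^*$ a language. The following are equivalent: 1. there are a finite alphabet $\Gamma$, a rational graph $G$ of finite out-degree labelled by $\Sigma$ with vertices in $\Gamma^*$, a vertex $i\in\Gamma^*$ and a rational (i.e. regular) language $F\subseteq\Gamma^*$ such that $L=L(G,\{i\},F)$; 2. $L\setminus\{\varepsilon\}$ is a context-sensitive language. In particular, a language that does not contain $\varepsilon$ is the path language of a rational graph of finite out-degree from a unique initial vertex to a rational set of final vertices if and only if it is context-sensitive. -/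

import Mathlib

/-- A finite transducer over `Γ`: a finite automaton over the product monoid `Γ* × Γ*` whose
labels lie in `(Γ ∪ {ε}) × (Γ ∪ {ε})`. In a label, `none` stands for `ε`. -/
structure Transducer (Γ : Type) where
  State : Type
  finite_state : Finite State
  init : State
  final : Set State
  trans : Set (State × (Option Γ × Option Γ) × State)

namespace Transducer

variable {Γ : Type}

/-- `T.Run q u v q'`: some run of `T` goes from `q` to `q'` and is associated to `(u, v)`. -/
inductive Run (T : Transducer Γ) : T.State → List Γ → List Γ → T.State → Prop
  | nil (q : T.State) : Run T q [] [] q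
  | cons {q q' q'' : T.State} {x y : Option Γ} {u v : List Γ} :
      (q, (x, y), q') ∈ T.trans → Run T q' u v q'' →
        Run T q (x.toList ++ u) (y.toList ++ v) q''

/-- `T.Accepts u v`: the pair `(u, v)` belongs to the relation recognized by `T`. -/
def Accepts (T : Transducer Γ) (u v : List Γ) : Prop :=
  ∃ q ∈ T.final, T.Run T.init u v q

end Transducer

/-- A rational graph labelled by `α`, with vertices in `Γ*`: one transducer over `Γ` for each
label. -/
structure RationalGraph (α : Type*) (Γ : Type) where
  transducer : α → Transducer Γ

namespace RationalGraph

variable {α : Type*} {Γ : Type}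

/-- `G.Edge u a v`: the graph has an edge labelled `a` from `u` to `v`. -/
def Edge (G : RationalGraph α Γ) (u : List Γ) (a : α) (v : List Γ) : Prop :=
  (G.transducer a).Accepts u v

/-- `G.Path u w v`: the graph has a path from `u` to `v` whose label is `w`. -/
inductive Path (G : RationalGraph α Γ) : List Γ → List α → List Γ → Prop
  | nil (u : List Γ) : Path G u [] u
  | cons {u u' v : List Γ} {a : α} {w : List α} :
      G.Edge u a u' → Path G u' w v → Path G u (a :: w) v

/-- The path language of `G` between the sets of vertices `I` and `F`. -/
def pathLanguage (G : RationalGraph α Γ) (I F : Language Γ) : Language α :=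
  {w | ∃ s ∈ I, ∃ t ∈ F, G.Path s w t}

/-- Every vertex is the source of only finitely many edges. -/
def FiniteOutDegree (G : RationalGraph α Γ) : Prop :=
  ∀ u : List Γ, {e : α × List Γ | G.Edge u e.1 e.2}.Finite

end RationalGraph

/-- A context-sensitive rule `left A right → left output right`, where `A` is a nonterminal and
`output` is a nonempty string of terminals and nonterminals. -/
structure ContextSensitiveRule (T N : Type*) where
  left : List (Symbol T N)
  input : N
  right : List (Symbol T N)
  output : List (Symbol T N)
  output_ne_nil : output ≠ []

/-- One application of the rule `r`, at some place of a sentential form. -/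
def ContextSensitiveRule.Rewrites {T N : Type*} (r : ContextSensitiveRule T N)
    (x y : List (Symbol T N)) : Prop :=
  ∃ p q : List (Symbol T N),
    x = p ++ r.left ++ [Symbol.nonterminal r.input] ++ r.right ++ q ∧
    y = p ++ r.left ++ r.output ++ r.right ++ q

/-- A context-sensitive grammar with terminal alphabet `T`: finitely many nonterminals, a start
symbol, and finitely many context-sensitive rules. -/
structure ContextSensitiveGrammar (T : Type*) where
  NT : Type
  finite_NT : Finite NT
  initial : NT
  rules : Set (ContextSensitiveRule T NT)
  finite_rules : rules.Finite

namespace ContextSensitiveGrammar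

variable {T : Type*}

/-- One derivation step of the grammar. -/
def Produces (g : ContextSensitiveGrammar T) (x y : List (Symbol T g.NT)) : Prop :=
  ∃ r ∈ g.rules, r.Rewrites x y

/-- The language generated by the grammar: the terminal words that can be derived from the start
symbol. As no rule shortens a sentential form, it never contains the empty word. -/
def language (g : ContextSensitiveGrammar T) : Language T :=
  {w | Relation.ReflTransGen g.Produces [Symbol.nonterminal g.initial] (w.map Symbol.terminal)}

end ContextSensitiveGrammar

/-- A language is context-sensitive when some context-sensitive grammar generates it. Such
languages do not contain the empty word. -/
def Language.IsContextSensitive {T : Type*} (L : Language T) : Prop :=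
  ∃ g : ContextSensitiveGrammar T, g.language = L

/-! From graphs to grammars: a word labels an accepted path when the transducers of its letters can
be chained, each reading what its left neighbour writes. A grammar can run all of them at once in
linear space, with one nonterminal cell per letter. Neighbouring cells exchange letters through a
one-letter buffer and two parity bits, so that a rule changes a single cell and only inspects a
neighbour. The initial vertex and the automaton for the final vertices are absorbed into the two end
transducers, and the path becomes one from the empty word to itself. Soundness is the invariant
`Past`, a decomposition into partial runs; completeness is `Future.progress`, absence of deadlock
with a decreasing measure.

From grammars to graphs: reversed derivation steps, on rows padded with blanks, are recognized by a
finite automaton comparing two rows. A nonempty word belongs to the language when its row can be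
made blank. By pigeonhole (`Blanks.blanksIn`) exponentially many steps suffice. The history of the
rows forms a rectangle whose width is the length of the word. Its columns could be processed letter
by letter, but a vertex would have to hold a column of exponential height from the start, while
finite out-degree excludes guessing the height. Hence the tape is folded: the first half of the word
is pushed on a stack while a clock word is multiplied by a constant at each letter. Each letter of
the second half then supplies two tape cells, itself and one from the stack, on either side of the
part already treated, and the vertex stores the pairs of automaton states at its two borders, one
pair per time step. `tapeGraph_mem_pathLanguage` is the outcome. -/

/-! ### Concatenation of runs and paths. -/

namespace Transducer

variable {Γ : Type} {T : Transducer Γ}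

theorem Run.append {q q' q'' : T.State} {u v u' v' : List Γ} (h : T.Run q u v q')
    (h' : T.Run q' u' v' q'') : T.Run q (u ++ u') (v ++ v') q'' := by
  induction h with
  | nil q => simpa using h'
  | cons ht _ ih => simpa [List.append_assoc] using Run.cons ht (ih h')

theorem Run.cases_head {q q' : T.State} {u v : List Γ} (h : T.Run q u v q') :
    (q' = q ∧ u = [] ∧ v = []) ∨ ∃ x y r u' v', (q, (x, y), r) ∈ T.trans ∧
      u = x.toList ++ u' ∧ v = y.toList ++ v' ∧ T.Run r u' v' q' := by
  cases h with
  | nil => exact Or.inl ⟨rfl, rfl, rfl⟩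
  | cons ht hr => exact Or.inr ⟨_, _, _, _, _, ht, rfl, rfl, hr⟩

theorem Run.single {q q' : T.State} {x y : Option Γ} (h : (q, (x, y), q') ∈ T.trans) :
    T.Run q x.toList y.toList q' := by
  simpa using Run.cons h (Run.nil q')

end Transducer

namespace RationalGraph

variable {α : Type*} {Γ : Type} {G : RationalGraph α Γ}

theorem Path.append {u v z : List Γ} {w w' : List α} (h : G.Path u w v) (h' : G.Path v w' z) :
    G.Path u (w ++ w') z := by
  induction h with
  | nil u => simpa using h'
  | cons he _ ih => exact Path.cons he (ih h')

theorem path_nil_iff {u v : List Γ} : G.Path u [] v ↔ u = v := by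
  constructor
  · intro h; cases h; rfl
  · rintro rfl; exact Path.nil u

theorem path_cons_iff {u v : List Γ} {a : α} {w : List α} :
    G.Path u (a :: w) v ↔ ∃ u', G.Edge u a u' ∧ G.Path u' w v := by
  constructor
  · intro h; cases h with | cons he hp => exact ⟨_, he, hp⟩
  · rintro ⟨u', he, hp⟩; exact Path.cons he hp

theorem path_append_iff {u v : List Γ} {w w' : List α} :
    G.Path u (w ++ w') v ↔ ∃ z, G.Path u w z ∧ G.Path z w' v := by
  induction w generalizing u with
  | nil => simp [path_nil_iff]
  | cons a w ih =>
    simp only [List.cons_append, path_cons_iff, ih]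
    constructor
    · rintro ⟨u', he, z, h1, h2⟩; exact ⟨z, ⟨u', he, h1⟩, h2⟩
    · rintro ⟨z, ⟨u', he, h1⟩, h2⟩; exact ⟨u', he, z, h1, h2⟩

theorem path_concat_iff {u v : List Γ} {a : α} {w : List α} :
    G.Path u (w ++ [a]) v ↔ ∃ z, G.Path u w z ∧ G.Edge z a v := by
  simp [path_append_iff, path_cons_iff, path_nil_iff]

end RationalGraph

/-! ### A grammar simulating a pipeline of transducers -/

namespace Pipeline

variable {α : Type*} {β Γ : Type}

/-- A cell of the pipeline runs the transducer of its label. It offers its last output letter in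
`out`; the letter is still unread when `outBit` differs from the `inBit` of the next cell. -/
structure Cell (H : RationalGraph β Γ) where
  label : β
  state : (H.transducer label).State
  inBit : Bool
  outBit : Bool
  out : Option Γ

/-- Nonterminals of the pipeline grammar: generators of cells, and cells. -/
inductive NT (H : RationalGraph β Γ)
  | gen (atStart : Bool) : NT H
  | cell (c : Cell H) : NT H

variable {H : RationalGraph β Γ}

def Cell.fresh (H : RationalGraph β Γ) (b : β) : Cell H :=
  ⟨b, (H.transducer b).init, false, false, none⟩

/-- The cell after a transition labelled `(x, y)` to the state `q`. -/
def Cell.move (c : Cell H) (x y : Option Γ) (q : (H.transducer c.label).State) : Cell H :=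
  ⟨c.label, q, xor c.inBit x.isSome, xor c.outBit y.isSome, y.or c.out⟩

/-- Only the buffer is emptied: the bits stay, so the parity comparison with the right neighbour
survives. -/
def Cell.clear (c : Cell H) : Cell H := ⟨c.label, c.state, c.inBit, c.outBit, none⟩

abbrev Form (α : Type*) (H : RationalGraph β Γ) := List (Symbol α (NT H))

/-- The sentential symbol of a cell. -/
abbrev sym (α : Type*) (c : Cell H) : Symbol α (NT H) := Symbol.nonterminal (NT.cell c)

abbrev genSym (α : Type*) (H : RationalGraph β Γ) (g : Bool) : Symbol α (NT H) :=
  Symbol.nonterminal (NT.gen g)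

variable (H) in
/-- The rules of the pipeline grammar. -/
inductive Rule (lab : β → α) (first last : β → Bool) : ContextSensitiveRule α (NT H) → Prop
  | genMore (b : β) : last b = false →
      Rule lab first last ⟨[], NT.gen (first b), [],
        [sym α (Cell.fresh H b), genSym α H false], by simp⟩
  | genLast (b : β) : last b = true →
      Rule lab first last ⟨[], NT.gen (first b), [], [sym α (Cell.fresh H b)], by simp⟩
  | silent (c : Cell H) (y : Option Γ) (q : (H.transducer c.label).State) :
      (c.state, (none, y), q) ∈ (H.transducer c.label).trans → (y = none ∨ c.out = none) →
      Rule lab first last ⟨[], NT.cell c, [], [sym α (c.move none y q)], by simp⟩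
  | read (c l : Cell H) (x : Γ) (y : Option Γ) (q : (H.transducer c.label).State) :
      (c.state, (some x, y), q) ∈ (H.transducer c.label).trans → (y = none ∨ c.out = none) →
      l.out = some x → l.outBit ≠ c.inBit →
      Rule lab first last ⟨[sym α l], NT.cell c, [], [sym α (c.move (some x) y q)], by simp⟩
  | clear (c r : Cell H) : c.outBit = r.inBit →
      Rule lab first last ⟨[], NT.cell c, [sym α r], [sym α c.clear], by simp⟩
  | finish (c : Cell H) : c.state ∈ (H.transducer c.label).final → c.out = none →
      Rule lab first last ⟨[], NT.cell c, [], [Symbol.terminal (lab c.label)], by simp⟩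

/-- The label words of the pipelines that a generator may build; the generator that remains, if
any, is recorded in the first argument. -/
inductive Generated (first last : β → Bool) : Option Bool → List β → Prop
  | start : Generated first last (some true) []
  | more {bs : List β} (b : β) : Generated first last (some (first b)) bs → last b = false →
      Generated first last (some false) (bs ++ [b])
  | done {bs : List β} (b : β) : Generated first last (some (first b)) bs → last b = true →
      Generated first last none (bs ++ [b])

/-- The letter offered in `o` by a cell with output bit `p`, when the next cell has not read it. -/
def pending (o : Option Γ) (p i : Bool) : List Γ := if p = i then [] else o.toList

@[simp] theorem pending_self (o : Option Γ) (p : Bool) : pending o p p = [] := by simp [pending]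

@[simp] theorem pending_none (p i : Bool) : pending (none : Option Γ) p i = [] := by
  simp [pending]

theorem pending_of_ne {o : Option Γ} {p i : Bool} (h : p ≠ i) : pending o p i = o.toList := by
  simp [pending, h]

/-! ### Soundness of the pipeline grammar. -/

variable (H) in
/-- `Past lab p o v bs t x`: the cells of `x`, which carry the labels `bs`, have reached their
states by runs, when the cells to their left, which have output `v` so far, offer `o` with output
bit `p`; the form `x` ends with the generator `t`. -/
inductive Past (lab : β → α) :
    Bool → Option Γ → List Γ → List β → Option Bool → Form α H → Prop
  | nil {p o v} : v = pending o p false → (o = none → p = false) → Past lab p o v [] none []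
  | gen {p o v} (g : Bool) : v = pending o p false → (o = none → p = false) →
      Past lab p o v [] (some g) [genSym α H g]
  | cell {p o v u v' bs t x} (c : Cell H) : v = u ++ pending o p c.inBit →
      (o = none → p = c.inBit) →
      (H.transducer c.label).Run (H.transducer c.label).init u v' c.state →
      Past lab c.outBit c.out v' bs t x → Past lab p o v (c.label :: bs) t (sym α c :: x)
  | terminal {p o v u v' bs t x p'} (b : β) : (o = none → v = u) → H.Edge u b v' →
      Past lab p' none v' bs t x → Past lab p o v (b :: bs) t (Symbol.terminal (lab b) :: x)

variable {lab : β → α} {first last : β → Bool}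

/-- With an empty buffer the two parities agree, so flipping one makes exactly the new letter
pending. Next to a terminal the obligation becomes vacuous: a letter written there can never be
cleared, and its writer can never finish. -/
theorem Past.write {p : Bool} {o : Option Γ} {v : List Γ} {bs : List β} {t : Option Bool}
    {x : Form α H} (y : Γ) (h : Past H lab p o v bs t x) (ho : o = none) :
    Past H lab (!p) (some y) (v ++ [y]) bs t x := by
  subst ho
  cases h with
  | nil hv hp =>
    obtain rfl := hp rfl
    subst hv
    exact Past.nil (by simp [pending]) (by simp)
  | gen g hv hp =>
    obtain rfl := hp rfl
    subst hv
    exact Past.gen g (by simp [pending]) (by simp)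
  | cell c hv hp hr hx =>
    obtain rfl := hp rfl
    subst hv
    exact Past.cell c (by simp [pending]) (by simp) hr hx
  | terminal b hv he hx => exact Past.terminal b (by simp) he hx

theorem Past.output {p : Bool} {o : Option Γ} {v : List Γ} {bs : List β} {t : Option Bool}
    {x : Form α H} (y : Option Γ) (h : Past H lab p o v bs t x) (ho : y = none ∨ o = none) :
    Past H lab (xor p y.isSome) (y.or o) (v ++ y.toList) bs t x := by
  cases y with
  | none => simpa using h
  | some y => simpa using h.write y (by simpa using ho)

theorem Past.move {p : Bool} {o : Option Γ} {v : List Γ} {bs : List β} {t : Option Bool}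
    {z : Form α H} {c : Cell H} {x y : Option Γ} {q : (H.transducer c.label).State}
    (h : Past H lab p o v bs t (sym α c :: z))
    (ht : (c.state, (x, y), q) ∈ (H.transducer c.label).trans) (hy : y = none ∨ c.out = none)
    (hx : x = none ∨ o = x ∧ p ≠ c.inBit) : Past H lab p o v bs t (sym α (c.move x y q) :: z) := by
  cases h with
  | cell _ hv hp hr hz =>
    rename_i u v' bs
    refine Past.cell (u := u ++ x.toList) (c.move x y q) ?_ ?_
      (hr.append (Transducer.Run.single ht)) (hz.output y hy)
    · rcases hx with rfl | ⟨rfl, hne⟩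
      · simpa [Cell.move] using hv
      · rw [hv, pending_of_ne hne]
        cases o with
        | none => simp
        | some o =>
          have : p = !c.inBit := by revert hne; cases p <;> cases c.inBit <;> simp
          simp [Cell.move, this]
    · rcases hx with rfl | ⟨rfl, hne⟩
      · simpa [Cell.move] using hp
      · intro ho; exact absurd (hp ho) hne

/-- A left context acts on what follows only through the triple `p'`, `o'`, `v'`, so a factor may be
exchanged for any other that fits this triple. As a generator ends the form, `y ≠ []` keeps it out
of `x`. -/
theorem Past.frame {p : Bool} {o : Option Γ} {v : List Γ} {bs : List β} {t : Option Bool}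
    {x y : Form α H} (h : Past H lab p o v bs t (x ++ y)) (hy : y ≠ []) :
    ∃ p' o' v' bs₁ bs₂, bs = bs₁ ++ bs₂ ∧ Past H lab p' o' v' bs₂ t y ∧
      ∀ bs' t' y', Past H lab p' o' v' bs' t' y' → Past H lab p o v (bs₁ ++ bs') t' (x ++ y') := by
  induction x generalizing p o v bs with
  | nil => exact ⟨p, o, v, [], bs, rfl, h, fun _ _ _ h => h⟩
  | cons s x ih =>
    rw [List.cons_append] at h
    generalize hz : x ++ y = z at h
    cases h with
    | gen g hv hp =>
      simp at hz; exact absurd hz.2 hy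
    | cell c hv hp hr hx =>
      subst hz
      obtain ⟨p', o', v', bs₁, bs₂, rfl, h1, h2⟩ := ih hx
      exact ⟨p', o', v', c.label :: bs₁, bs₂, rfl, h1, fun bs' t' y' h =>
        Past.cell c hv hp hr (h2 _ _ _ h)⟩
    | terminal b hv he hx =>
      subst hz
      obtain ⟨p', o', v', bs₁, bs₂, rfl, h1, h2⟩ := ih hx
      exact ⟨p', o', v', b :: bs₁, bs₂, rfl, h1, fun bs' t' y' h =>
        Past.terminal b hv he (h2 _ _ _ h)⟩

/-- The invariant of the derivations of the pipeline grammar. -/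
def Invariant (H : RationalGraph β Γ) (lab : β → α) (first last : β → Bool) (x : Form α H) : Prop :=
  ∃ bs t, Generated first last t bs ∧ Past H lab false none [] bs t x

/-- The second alternative serves the two generator rules, the only ones that lengthen the label
word. -/
theorem Past.replace {p : Bool} {o : Option Γ} {v : List Γ} {bs : List β} {t : Option Bool}
    {r : ContextSensitiveRule α (NT H)} {q : Form α H} (hr : Rule H lab first last r)
    (h : Past H lab p o v bs t (r.left ++ [Symbol.nonterminal r.input] ++ r.right ++ q)) :
    (Past H lab p o v bs t (r.left ++ r.output ++ r.right ++ q)) ∨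
      ∃ b, bs = [] ∧ t = some (first b) ∧
        Past H lab p o v [b] (if last b then none else some false)
          (r.left ++ r.output ++ r.right ++ q) := by
  cases hr with
  | genMore b hb =>
    right
    cases h with
    | gen g hv hp =>
      refine ⟨b, rfl, rfl, ?_⟩
      rw [if_neg (by simp [hb])]
      exact Past.cell (u := []) (Cell.fresh H b) (by simpa [Cell.fresh] using hv) hp
        (Transducer.Run.nil _) (Past.gen false (by simp [Cell.fresh]) (fun _ => rfl))
  | genLast b hb =>
    right
    cases h with
    | gen g hv hp =>
      refine ⟨b, rfl, rfl, ?_⟩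
      rw [if_pos hb]
      exact Past.cell (u := []) (Cell.fresh H b) (by simpa [Cell.fresh] using hv) hp
        (Transducer.Run.nil _) (Past.nil (by simp [Cell.fresh]) (fun _ => rfl))
  | silent c y q' ht hy =>
    left
    exact Past.move h ht hy (Or.inl rfl)
  | read c l x y q' ht hy hl hne =>
    left
    cases h with
    | cell _ hv hp hr hz => exact Past.cell l hv hp hr (Past.move hz ht hy (Or.inr ⟨hl, hne⟩))
  | clear c r hcr =>
    left
    cases h with
    | cell _ hv hp hr hz =>
      refine Past.cell c.clear hv hp hr ?_
      -- Equal bits mean that `r` has already read the buffer, so erasing it loses no pending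
      -- letter.
      cases hz with
      | cell _ hv hp hr hz =>
        exact Past.cell r (by rw [hv, hcr]; simp [Cell.clear, hcr]) (fun _ => hcr) hr hz
  | finish c hc ho =>
    left
    cases h with
    | cell _ hv hp hr hz =>
      refine Past.terminal c.label ?_ ⟨_, hc, hr⟩ (ho ▸ hz)
      rintro rfl; simpa using hv

theorem Invariant.step {r : ContextSensitiveRule α (NT H)} {x y : Form α H}
    (hr : Rule H lab first last r) (hxy : r.Rewrites x y) (h : Invariant H lab first last x) :
    Invariant H lab first last y := by
  obtain ⟨p, q, rfl, rfl⟩ := hxy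
  obtain ⟨bs, t, hg, hp⟩ := h
  have e : p ++ r.left ++ [Symbol.nonterminal r.input] ++ r.right ++ q =
    p ++ (r.left ++ [Symbol.nonterminal r.input] ++ r.right ++ q) := by simp
  rw [e] at hp
  obtain ⟨p', o', v', bs₁, bs₂, rfl, h1, h2⟩ := hp.frame (by simp)
  have e : p ++ r.left ++ r.output ++ r.right ++ q =
    p ++ (r.left ++ r.output ++ r.right ++ q) := by simp
  rw [e]
  rcases h1.replace hr with h3 | ⟨b, rfl, rfl, h3⟩
  · exact ⟨_, _, hg, h2 _ _ _ h3⟩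
  · refine ⟨_, _, ?_, h2 _ _ _ h3⟩
    rw [List.append_nil] at hg
    by_cases hb : last b = true
    · rw [if_pos hb]; exact Generated.done b hg hb
    · rw [if_neg hb]; exact Generated.more b hg (by simpa using hb)

/-- Every buffer beside a terminal is now empty, so each output equals the next input, and the runs
chain into edges. Past the last cell nobody reads, which forces the end vertex to be empty. -/
theorem Past.path {p : Bool} {v : List Γ} {bs : List β} {t : Option Bool} {w : List α}
    (h : Past H lab p none v bs t (w.map Symbol.terminal)) :
    t = none ∧ bs.map lab = w ∧ H.Path v bs [] := by
  induction w generalizing p v bs with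
  | nil =>
    cases h with
    | nil hv hp => exact ⟨rfl, rfl, by rw [hv]; simpa using RationalGraph.Path.nil _⟩
  | cons a w ih =>
    cases h with
    | terminal b hv he hx =>
      obtain ⟨h1, h2, h3⟩ := ih hx
      exact ⟨h1, by simp [h2], RationalGraph.Path.cons (hv rfl ▸ he) h3⟩

end Pipeline

/-! ### Completeness of the pipeline grammar. -/

namespace Transducer

variable {Γ : Type}

/-- `T.RunOfLength n q u v q'`: a run of `n` transitions from `q` to `q'` associated to `(u, v)`. -/
inductive RunOfLength (T : Transducer Γ) : ℕ → T.State → List Γ → List Γ → T.State → Prop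
  | nil (q : T.State) : RunOfLength T 0 q [] [] q
  | cons {n : ℕ} {q q' q'' : T.State} {x y : Option Γ} {u v : List Γ} :
      (q, (x, y), q') ∈ T.trans → RunOfLength T n q' u v q'' →
        RunOfLength T (n + 1) q (x.toList ++ u) (y.toList ++ v) q''

theorem RunOfLength.eq_of_zero {T : Transducer Γ} {q q' : T.State} {u v : List Γ}
    (h : T.RunOfLength 0 q u v q') : q' = q := by
  cases h; rfl

theorem Run.exists_length {T : Transducer Γ} {q q' : T.State} {u v : List Γ} (h : T.Run q u v q') :
    ∃ n, T.RunOfLength n q u v q' := by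
  induction h with
  | nil q => exact ⟨0, RunOfLength.nil q⟩
  | cons ht _ ih => obtain ⟨n, hn⟩ := ih; exact ⟨n + 1, RunOfLength.cons ht hn⟩

end Transducer

namespace Pipeline

variable {α : Type*} {β Γ : Type} {H : RationalGraph β Γ}

variable (H) in
/-- `Future p o v cs n`: the cells of `cs` can complete their work when the cells to their left
offer `o` with output bit `p` and will still output `v`; the number `n` measures this work. -/
inductive Future : Bool → Option Γ → List Γ → List (Cell H) → ℕ → Prop
  | nil (p) : Future p none [] [] 0
  | cell {p o v v' cs m n} (c : Cell H) {q : (H.transducer c.label).State} :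
      (H.transducer c.label).RunOfLength m c.state (pending o p c.inBit ++ v) v' q →
      q ∈ (H.transducer c.label).final → (o = none → p = c.inBit) →
      Future c.outBit c.out v' cs n →
      Future p o v (c :: cs) (2 * m + c.out.toList.length + n)

variable (H) in
/-- `Move l cs cs'`: the row of cells `cs` changes to `cs'` by one rule, when `l` is on its left. -/
inductive Move : Option (Cell H) → List (Cell H) → List (Cell H) → Prop
  | silent {l : Option (Cell H)} {cs} (c : Cell H) (y : Option Γ)
      (q : (H.transducer c.label).State) :
      (c.state, (none, y), q) ∈ (H.transducer c.label).trans → (y = none ∨ c.out = none) →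
      Move l (c :: cs) (c.move none y q :: cs)
  | read {cs} (c l : Cell H) (x : Γ) (y : Option Γ) (q : (H.transducer c.label).State) :
      (c.state, (some x, y), q) ∈ (H.transducer c.label).trans → (y = none ∨ c.out = none) →
      l.out = some x → l.outBit ≠ c.inBit → Move (some l) (c :: cs) (c.move (some x) y q :: cs)
  | clear {l : Option (Cell H)} {cs} (c r : Cell H) : c.outBit = r.inBit →
      Move l (c :: r :: cs) (c.clear :: r :: cs)
  | next {l : Option (Cell H)} {cs cs'} (c : Cell H) : Move (some c) cs cs' →
      Move l (c :: cs) (c :: cs')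

theorem Future.cons_inv {p : Bool} {o : Option Γ} {v : List Γ} {c : Cell H} {cs : List (Cell H)}
    {k : ℕ} (h : Future H p o v (c :: cs) k) : ∃ v' m n, ∃ q : (H.transducer c.label).State,
      (H.transducer c.label).RunOfLength m c.state (pending o p c.inBit ++ v) v' q ∧
      q ∈ (H.transducer c.label).final ∧ (o = none → p = c.inBit) ∧
      Future H c.outBit c.out v' cs n ∧ k = 2 * m + c.out.toList.length + n := by
  cases h with
  | cell _ hr hq hp hcs => exact ⟨_, _, _, _, hr, hq, hp, hcs, rfl⟩

theorem Future.write {p : Bool} {y : Γ} {v : List Γ} {cs : List (Cell H)} {n : ℕ}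
    (h : Future H p none (y :: v) cs n) : Future H (!p) (some y) v cs n := by
  cases h with
  | cell c hr hq hp hcs =>
    obtain rfl := hp rfl
    exact Future.cell c (by simpa [pending] using hr) hq (by simp) hcs

theorem Future.output {p : Bool} {y : Option Γ} {v : List Γ} {cs : List (Cell H)} {n : ℕ}
    (h : Future H p none (y.toList ++ v) cs n) : Future H (xor p y.isSome) (y.or none) v cs n := by
  cases y with
  | none => simpa using h
  | some y => simpa using h.write

/-- There is no deadlock: `ha` says that the head cell is not waiting for a letter, and a cell that
cannot move itself passes this property to its right neighbour. A pending transition weighs 2 and a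
full buffer 1, so a transition that writes, like a clearing, lowers the measure. -/
theorem Future.progress {l : Option (Cell H)} {p : Bool} {o : Option Γ} {v : List Γ}
    {cs : List (Cell H)} {n : ℕ} (h : Future H p o v cs n)
    (hl : ∀ x, o = some x → ∃ c, l = some c ∧ c.outBit = p ∧ c.out = some x)
    (ha : ∀ c ∈ cs.head?, v = [] ∨ p ≠ c.inBit) :
    n = 0 ∨ ∃ cs' n', n' < n ∧ Move H l cs cs' ∧ Future H p o v cs' n' := by
  induction cs generalizing l p o v n with
  | nil => cases h with | nil p => exact Or.inl rfl
  | cons c cs ih =>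
    cases h with
    | cell _ hr hq hp hcs =>
    rename_i v' m n q
    cases ho : c.out with
    | some y₀ =>
      right
      -- The end of the row accepts only an empty buffer, so a full one has a reader.
      have key : ∃ r cs₁, cs = r :: cs₁ := by
        rw [ho] at hcs
        cases hcs with | cell r => exact ⟨_, _, rfl⟩
      obtain ⟨r, cs₁, rfl⟩ := key
      by_cases hcr : c.outBit = r.inBit
      · refine ⟨c.clear :: r :: cs₁, 2 * m + 0 + n, by simp, Move.clear c r hcr, ?_⟩
        refine Future.cell (n := n) c.clear hr hq hp ?_
        obtain ⟨v₁, m₁, n₁, q₁, hr', hq', hp', hcs', rfl⟩ := hcs.cons_inv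
        exact Future.cell r (by simpa [Cell.clear, hcr] using hr') hq' (fun _ => hcr) hcs'
      · rcases ih (l := some c) hcs (fun x hx => ⟨c, rfl, rfl, hx⟩)
          (by simp [hcr]) with hn | ⟨cs', n', hlt, hm, hf⟩
        -- Measure zero is impossible to the right, since the pending letter still needs a
        -- transition of `r`.
        · exfalso
          obtain ⟨v₁, m', n₁, q₁, hr', hq', hp', hcs', hk⟩ := hcs.cons_inv
          obtain rfl : m' = 0 := by omega
          rw [pending_of_ne hcr, ho] at hr'
          generalize hz : (some y₀).toList ++ v' = z at hr'
          cases hr'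
          simp at hz
        · exact ⟨c :: cs', _, by simp only [ho]; omega, Move.next c hm, Future.cell c hr hq hp hf⟩
    | none =>
      generalize hz : pending o p c.inBit ++ v = z at hr
      cases hr with
      | nil =>
        rcases ih (l := some c) hcs (fun x hx => ⟨c, rfl, rfl, hx⟩)
          (by simp) with hn | ⟨cs', n', hlt, hm, hf⟩
        · left; simp [hn]
        · right
          refine ⟨c :: cs', _, ?_, Move.next c hm,
            Future.cell c (m := 0) (by rw [hz]; exact Transducer.RunOfLength.nil _) hq hp hf⟩
          simpa [ho] using hlt
      | @cons k _ q' _ x y u v'' ht hr =>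
        right
        rw [ho] at hcs
        have hcs' := hcs.output
        cases x with
        | none =>
          refine ⟨c.move none y q' :: cs, _, ?_, Move.silent c y q' ht (Or.inr ho),
            Future.cell (m := k) (n := n) (c.move none y q') (v' := v'') ?_ hq ?_ ?_⟩
          rotate_left
          · simpa [Cell.move, hz] using hr
          · simpa [Cell.move] using hp
          · rw [← ho] at hcs'; exact hcs'
          · cases y <;> simp [Cell.move, ho]; omega
        | some x =>
          -- Equal bits leave nothing pending, and then `ha` leaves no future input either, although
          -- the next transition reads.
          by_cases hpi : p = c.inBit
          · exfalso
            have := ha c (by simp)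
            simp [hpi] at this
            subst this
            simp [hpi] at hz
          · rw [pending_of_ne hpi] at hz
            cases hox : o with
            | none => exact absurd (hp hox) hpi
            | some x' =>
              rw [hox] at hz
              simp at hz
              obtain ⟨rfl, rfl⟩ := hz
              obtain ⟨L, rfl, hL, hLo⟩ := hl _ hox
              have hpi' : p = !c.inBit := by revert hpi; cases p <;> cases c.inBit <;> simp
              refine ⟨c.move (some x') y q' :: cs, _, ?_,
                Move.read c L x' y q' ht (Or.inr ho) hLo (hL ▸ hpi),
                Future.cell (m := k) (n := n) (c.move (some x') y q') (v' := v'') ?_ hq ?_ ?_⟩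
              rotate_left
              · simpa [Cell.move, hpi'] using hr
              · simp
              · rw [← ho] at hcs'; exact hcs'
              · cases y <;> simp [Cell.move, ho]; omega

theorem Future.of_path {bs : List β} {v : List Γ} (h : H.Path v bs []) :
    ∃ n, Future H false none v (bs.map (Cell.fresh H)) n := by
  induction bs generalizing v with
  | nil => cases h with | nil => exact ⟨0, Future.nil false⟩
  | cons b bs ih =>
    obtain ⟨v', ⟨q, hq, hr⟩, hp⟩ := RationalGraph.path_cons_iff.1 h
    obtain ⟨n, hn⟩ := ih hp
    obtain ⟨m, hm⟩ := hr.exists_length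
    exact ⟨_, Future.cell (Cell.fresh H b) (by simpa [Cell.fresh] using hm) hq (fun _ => rfl) hn⟩

theorem Future.finished {p : Bool} {o : Option Γ} {v : List Γ} {cs : List (Cell H)}
    (h : Future H p o v cs 0) :
    ∀ c ∈ cs, c.state ∈ (H.transducer c.label).final ∧ c.out = none := by
  generalize hn : 0 = n at h
  induction h with
  | nil => simp
  | cell c hr hq hp hcs ih =>
    rename_i m n q
    obtain ⟨hm, ho, hn⟩ : m = 0 ∧ c.out = none ∧ 0 = n := by
      refine ⟨by omega, ?_, by omega⟩
      cases ho : c.out with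
      | none => rfl
      | some x => simp [ho] at hn; omega
    intro c' hc'
    rcases List.mem_cons.1 hc' with rfl | hc'
    · subst hm
      exact ⟨hr.eq_of_zero ▸ hq, ho⟩
    · exact ih hn c' hc'

theorem Move.labels {l : Option (Cell H)} {cs cs' : List (Cell H)} (h : Move H l cs cs') :
    cs'.map Cell.label = cs.map Cell.label := by
  induction h with
  | next c _ ih => simp [ih]
  | _ => simp [Cell.move, Cell.clear]

variable {lab : β → α} {first last : β → Bool}

/-- One derivation step with the rules of the pipeline grammar. -/
def Derives (H : RationalGraph β Γ) (lab : β → α) (first last : β → Bool) (x y : Form α H) : Prop :=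
  ∃ r, Rule H lab first last r ∧ r.Rewrites x y

theorem Move.derives {l : Option (Cell H)} {cs cs' : List (Cell H)} (h : Move H l cs cs')
    (z : Form α H) : Derives H lab first last (z ++ (l.toList ++ cs).map (sym α))
      (z ++ (l.toList ++ cs').map (sym α)) := by
  induction h generalizing z with
  | @silent l cs c y q ht hy =>
    exact ⟨_, Rule.silent c y q ht hy, z ++ l.toList.map (sym α), cs.map (sym α),
      by simp, by simp⟩
  | @read cs c l x y q ht hy hl hne =>
    exact ⟨_, Rule.read c l x y q ht hy hl hne, z, cs.map (sym α), by simp, by simp⟩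
  | @clear l cs c r hcr =>
    exact ⟨_, Rule.clear c r hcr, z ++ l.toList.map (sym α), cs.map (sym α), by simp, by simp⟩
  | @next l cs cs' c _ ih => simpa using ih (z ++ l.toList.map (sym α))

theorem Derives.refl_trans_finish (cs : List (Cell H)) (z : Form α H)
    (h : ∀ c ∈ cs, c.state ∈ (H.transducer c.label).final ∧ c.out = none) :
    Relation.ReflTransGen (Derives H lab first last) (z ++ cs.map (sym α))
      (z ++ (cs.map Cell.label).map (fun b => Symbol.terminal (lab b))) := by
  induction cs generalizing z with
  | nil => simpa using Relation.ReflTransGen.refl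
  | cons c cs ih =>
    have hc := h c (by simp)
    refine Relation.ReflTransGen.head (b := z ++ [Symbol.terminal (lab c.label)] ++ cs.map (sym α))
      ⟨_, Rule.finish c hc.1 hc.2, z, cs.map (sym α), by simp, by simp⟩ ?_
    have := ih (z ++ [Symbol.terminal (lab c.label)]) fun c' hc' =>
        h c' (List.mem_cons_of_mem _ hc')
    simpa only [List.map_cons, List.append_assoc, List.singleton_append] using this

theorem Future.derives {cs : List (Cell H)} {n : ℕ} (h : Future H false none [] cs n) :
    Relation.ReflTransGen (Derives H lab first last) (cs.map (sym α))
      ((cs.map Cell.label).map (fun b => Symbol.terminal (lab b))) := by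
  induction n using Nat.strong_induction_on generalizing cs with
  | _ n ih =>
    -- Nothing is offered to the first cell, now or later, so both side conditions are trivial.
    rcases h.progress (l := none) (by simp) (by simp) with rfl | ⟨cs', n', hlt, hm, hf⟩
    · simpa using Derives.refl_trans_finish cs [] h.finished
    · have h1 := hm.derives (lab := lab) (first := first) (last := last) []
      have h2 := ih n' hlt hf
      rw [hm.labels] at h2
      exact Relation.ReflTransGen.head (by simpa using h1) h2

theorem Generated.derives {t : Option Bool} {bs : List β} (h : Generated first last t bs) :
    Relation.ReflTransGen (Derives H lab first last) [genSym α H true]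
      (bs.map (fun b => sym α (Cell.fresh H b)) ++ t.toList.map (genSym α H)) := by
  induction h with
  | start => simpa using Relation.ReflTransGen.refl
  | @more bs b _ hb ih =>
    refine ih.tail ⟨_, Rule.genMore b hb, bs.map (fun b => sym α (Cell.fresh H b)), [], ?_, ?_⟩ <;>
      simp
  | @done bs b _ hb ih =>
    refine ih.tail ⟨_, Rule.genLast b hb, bs.map (fun b => sym α (Cell.fresh H b)), [], ?_, ?_⟩ <;>
      simp

theorem finite_cell [Finite β] [Finite Γ] : Finite (Cell H) := by
  have := fun b => (H.transducer b).finite_state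
  refine Finite.of_injective
    (β := (Σ b, (H.transducer b).State) × Bool × Bool × Option Γ)
    (fun c => (⟨c.label, c.state⟩, c.inBit, c.outBit, c.out)) ?_
  rintro ⟨⟩ ⟨⟩ h
  simp only [Prod.mk.injEq, Sigma.mk.injEq] at h
  obtain ⟨⟨rfl, h⟩, rfl, rfl, rfl⟩ := h
  obtain rfl := eq_of_heq h
  rfl

theorem finite_nt [Finite β] [Finite Γ] : Finite (NT H) := by
  have := finite_cell (H := H)
  refine Finite.of_injective (β := Bool ⊕ Cell H)
    (fun | NT.gen g => Sum.inl g | NT.cell c => Sum.inr c) ?_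
  rintro (_ | _) (_ | _) h <;> simp_all

theorem finite_symbol {T N : Type*} [Finite T] [Finite N] : Finite (Symbol T N) := by
  refine Finite.of_injective (β := T ⊕ N)
    (fun | Symbol.terminal g => Sum.inl g | Symbol.nonterminal c => Sum.inr c) ?_
  rintro (_ | _) (_ | _) h <;> simp_all

theorem finite_rules_of_length_le {T N : Type*} [Finite T] [Finite N]
    {R : Set (ContextSensitiveRule T N)} (k : ℕ) (h : ∀ r ∈ R,
      r.left.length ≤ k ∧ r.right.length ≤ k ∧ r.output.length ≤ k) : R.Finite := by
  have := finite_symbol (T := T) (N := N)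
  have hl := List.finite_length_le (Symbol T N) k
  refine Set.Finite.of_finite_image
    (f := fun r => (r.left, r.input, r.right, r.output)) ?_ ?_
  · refine (hl.prod (Set.finite_univ.prod (hl.prod hl))).subset ?_
    rintro _ ⟨r, hr, rfl⟩
    have := h r hr
    exact ⟨this.1, trivial, this.2.1, this.2.2⟩
  · rintro ⟨⟩ _ ⟨⟩ _ h
    simp only [Prod.mk.injEq] at h
    obtain ⟨rfl, rfl, rfl, rfl⟩ := h
    rfl

theorem isContextSensitive [Finite α] [Finite β] [Finite Γ] (H : RationalGraph β Γ) (lab : β → α)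
    (first last : β → Bool) : Language.IsContextSensitive
      {w | ∃ bs, Generated first last none bs ∧ bs.map lab = w ∧ H.Path [] bs []} := by
  have := finite_nt (H := H)
  refine ⟨⟨NT H, this, NT.gen true, {r | Rule H lab first last r}, ?_⟩, ?_⟩
  · refine finite_rules_of_length_le 2 ?_
    rintro r (_ | _ | _ | _ | _ | _) <;> simp
  · ext w
    constructor
    · intro h
      have inv : ∀ x, Relation.ReflTransGen (Derives H lab first last) [genSym α H true] x →
          Invariant H lab first last x := by
        intro x hx
        induction hx with
        | refl => exact ⟨[], some true, Generated.start, Past.gen true (by simp) (fun _ => rfl)⟩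
        | tail _ hs ih => obtain ⟨r, hr, hs⟩ := hs; exact ih.step hr hs
      obtain ⟨bs, t, hg, hp⟩ := inv _ h
      obtain ⟨rfl, h1, h2⟩ := hp.path
      exact ⟨bs, hg, h1, h2⟩
    · rintro ⟨bs, hg, rfl, hp⟩
      obtain ⟨n, hn⟩ := Future.of_path hp
      have h1 := hg.derives (H := H) (lab := lab)
      have h2 := hn.derives (lab := lab) (first := first) (last := last)
      simp only [List.map_map] at h2
      refine h1.trans ?_
      simpa [Function.comp_def, Cell.fresh] using h2

end Pipeline

/-! ### Absorbing the initial vertex and the final language. -/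

namespace Transducer

variable {Γ : Type}

/-- The transducer that runs `T` on the input word `i`, and has no input of its own. -/
def fixInput (T : Transducer Γ) (i : List Γ) : Transducer Γ where
  State := T.State × {l : List Γ // l <:+ i}
  finite_state := by
    have := T.finite_state
    have : Finite {l : List Γ // l <:+ i} := by
      have h : {l : List Γ | l <:+ i}.Finite :=
        (List.finite_toSet i.tails).subset fun l hl => by simpa using hl
      exact h
    infer_instance
  init := (T.init, ⟨i, List.suffix_rfl⟩)
  final := {s | s.1 ∈ T.final ∧ s.2.1 = []}
  trans := {t | t.2.1.1 = none ∧ ∃ x, (t.1.1, (x, t.2.1.2), t.2.2.1) ∈ T.trans ∧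
    t.1.2.1 = x.toList ++ t.2.2.2.1}

theorem Run.of_fixInput {T : Transducer Γ} {i : List Γ} {s s' : (T.fixInput i).State}
    {u v : List Γ} (h : (T.fixInput i).Run s u v s') :
    u = [] ∧ ∃ x, s.2.1 = x ++ s'.2.1 ∧ T.Run s.1 x v s'.1 := by
  induction h with
  | nil q => exact ⟨rfl, [], rfl, Run.nil _⟩
  | cons ht _ ih =>
    obtain ⟨h1, x, h2, h3⟩ := ht
    obtain ⟨rfl, z, h4, h5⟩ := ih
    dsimp only at h1 h2 h3
    subst h1
    exact ⟨rfl, x.toList ++ z, by rw [h3, h4, List.append_assoc], Run.cons h2 h5⟩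

theorem Run.fixInput {T : Transducer Γ} {i : List Γ} {q q' : T.State} {x v : List Γ}
    (h : T.Run q x v q') (l : List Γ) (hl : x ++ l <:+ i) :
    (T.fixInput i).Run (q, ⟨x ++ l, hl⟩) [] v
      (q', ⟨l, (List.suffix_append x l).trans hl⟩) := by
  induction h with
  | nil q => exact Run.nil _
  | @cons q₁ q₂ q₃ x y u v ht _ ih =>
    have hl' : u ++ l <:+ i := by
      refine List.IsSuffix.trans ?_ hl
      rw [List.append_assoc]
      exact List.suffix_append _ _
    exact Run.cons (T := T.fixInput i) (x := none) (y := y)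
      (show _ ∈ {t | _} from ⟨rfl, x, ht, by simp⟩) (ih hl')

theorem fixInput_accepts_iff {T : Transducer Γ} {i u v : List Γ} :
    (T.fixInput i).Accepts u v ↔ u = [] ∧ T.Accepts i v := by
  constructor
  · rintro ⟨q, ⟨hq, hq'⟩, h⟩
    obtain ⟨rfl, x, h1, h2⟩ := h.of_fixInput
    rw [hq', List.append_nil] at h1
    have h1 : i = x := h1
    subst h1
    exact ⟨rfl, q.1, hq, h2⟩
  · rintro ⟨rfl, q, hq, h⟩
    refine ⟨(q, ⟨[], List.nil_suffix⟩), ⟨hq, rfl⟩, ?_⟩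
    have := h.fixInput (i := i) [] (by simp)
    simpa [Transducer.fixInput] using this

/-- The transducer that checks that the output of `T` is accepted by the automaton `M`, and has no
output of its own. -/
def checkOutput {σ : Type} [Finite σ] (T : Transducer Γ) (M : DFA Γ σ) : Transducer Γ where
  State := T.State × σ
  finite_state := by
    have := T.finite_state
    infer_instance
  init := (T.init, M.start)
  final := {s | s.1 ∈ T.final ∧ s.2 ∈ M.accept}
  trans := {t | t.2.1.2 = none ∧ ∃ y : Option Γ, (t.1.1, (t.2.1.1, y), t.2.2.1) ∈ T.trans ∧
    t.2.2.2 = M.evalFrom t.1.2 y.toList}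

variable {σ : Type} [Finite σ] {M : DFA Γ σ}

theorem Run.of_checkOutput {T : Transducer Γ} {s s' : (T.checkOutput M).State}
    {u v : List Γ} (h : (T.checkOutput M).Run s u v s') :
    v = [] ∧ ∃ y, s'.2 = M.evalFrom s.2 y ∧ T.Run s.1 u y s'.1 := by
  induction h with
  | nil q => exact ⟨rfl, [], rfl, Run.nil _⟩
  | cons ht _ ih =>
    obtain ⟨h1, y, h2, h3⟩ := ht
    obtain ⟨rfl, z, h4, h5⟩ := ih
    dsimp only at h1 h2 h3
    subst h1
    exact ⟨rfl, y.toList ++ z, by rw [h4, h3, DFA.evalFrom_of_append], Run.cons h2 h5⟩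

theorem Run.checkOutput {T : Transducer Γ} {q q' : T.State} {u v : List Γ}
    (h : T.Run q u v q') (s : σ) :
    (T.checkOutput M).Run (q, s) u [] (q', M.evalFrom s v) := by
  induction h generalizing s with
  | nil q => exact Run.nil _
  | @cons q₁ q₂ q₃ x y u v ht _ ih =>
    rw [DFA.evalFrom_of_append]
    exact Run.cons (T := T.checkOutput M) (x := x) (y := none)
      (show _ ∈ {t | _} from ⟨rfl, y, ht, rfl⟩) (ih _)

theorem checkOutput_accepts_iff {T : Transducer Γ} {u v : List Γ} :
    (T.checkOutput M).Accepts u v ↔ v = [] ∧ ∃ y ∈ M.accepts, T.Accepts u y := by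
  constructor
  · rintro ⟨q, ⟨hq, hq'⟩, h⟩
    obtain ⟨rfl, y, h1, h2⟩ := h.of_checkOutput
    refine ⟨rfl, y, ?_, q.1, hq, h2⟩
    rw [DFA.mem_accepts, DFA.eval, ← show q.2 = M.evalFrom M.start y from h1]
    exact hq'
  · rintro ⟨rfl, y, hy, q, hq, h⟩
    exact ⟨(q, M.evalFrom M.start y), ⟨hq, hy⟩, h.checkOutput M.start⟩

end Transducer

namespace Pipeline

variable {α : Type*} {κ Γ σ : Type} [Finite σ]

/-- The pipeline of the transducers of `G`, where the first one reads the vertex `i` and the last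
one checks its output with `M`. -/
def closedGraph (G : RationalGraph α Γ) (lab : κ → α) (i : List Γ) (M : DFA Γ σ) :
    RationalGraph (κ × Bool × Bool) Γ where
  transducer b :=
    let T := G.transducer (lab b.1)
    let T' := if b.2.1 then T.fixInput i else T
    if b.2.2 then T'.checkOutput M else T'

variable {G : RationalGraph α Γ} {lab : κ → α} {i : List Γ} {M : DFA Γ σ}

theorem closedGraph_edge_start {a : κ} {v : List Γ} :
    (closedGraph G lab i M).Edge [] (a, true, false) v ↔ G.Edge i (lab a) v := by
  simp [closedGraph, RationalGraph.Edge, Transducer.fixInput_accepts_iff]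

theorem closedGraph_edge {a : κ} {u v : List Γ} :
    (closedGraph G lab i M).Edge u (a, false, false) v ↔ G.Edge u (lab a) v := by
  simp [closedGraph, RationalGraph.Edge]

theorem closedGraph_edge_last {a : κ} {u : List Γ} :
    (closedGraph G lab i M).Edge u (a, false, true) [] ↔ ∃ v ∈ M.accepts, G.Edge u (lab a) v := by
  simp [closedGraph, RationalGraph.Edge, Transducer.checkOutput_accepts_iff]

theorem closedGraph_edge_start_last {a : κ} :
    (closedGraph G lab i M).Edge [] (a, true, true) [] ↔
      ∃ v ∈ M.accepts, G.Edge i (lab a) v := by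
  simp [closedGraph, RationalGraph.Edge, Transducer.fixInput_accepts_iff,
    Transducer.checkOutput_accepts_iff]

/-- The generator sets the first flag on the first label only and the second flag on the last only;
a word of one letter carries both. All other edges are those of `G`. -/
theorem Generated.path_iff {t : Option Bool} {bs : List (κ × Bool × Bool)}
    (h : Generated (fun b => b.2.1) (fun b => b.2.2) t bs) :
    match t with
    | some true => bs = []
    | some false => bs ≠ [] ∧ ∀ v, (closedGraph G lab i M).Path [] bs v ↔
        G.Path i (bs.map fun b => lab b.1) v
    | none => bs ≠ [] ∧ ((closedGraph G lab i M).Path [] bs [] ↔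
        ∃ v ∈ M.accepts, G.Path i (bs.map fun b => lab b.1) v) := by
  induction h with
  | start => rfl
  | @more bs b _ hb ih =>
    obtain ⟨a, f, l⟩ := b
    dsimp only at hb ih ⊢
    subst hb
    refine ⟨by simp, fun v => ?_⟩
    cases f with
    | true =>
      dsimp only at ih
      subst ih
      simp [RationalGraph.path_cons_iff, RationalGraph.path_nil_iff, closedGraph_edge_start]
    | false =>
      simp [RationalGraph.path_concat_iff, closedGraph_edge, ih.2]
  | @done bs b _ hb ih =>
    obtain ⟨a, f, l⟩ := b
    dsimp only at hb ih ⊢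
    subst hb
    refine ⟨by simp, ?_⟩
    cases f with
    | true =>
      dsimp only at ih
      subst ih
      simp [RationalGraph.path_cons_iff, RationalGraph.path_nil_iff, closedGraph_edge_start_last]
    | false =>
      simp only [RationalGraph.path_concat_iff, closedGraph_edge_last, ih.2, List.map_append,
        List.map_cons, List.map_nil]
      constructor
      · rintro ⟨z, h1, v, h2, h3⟩; exact ⟨v, h2, z, h1, h3⟩
      · rintro ⟨v, h2, z, h1, h3⟩; exact ⟨z, h1, v, h2, h3⟩

theorem exists_generated_some (w : List κ) :
    ∃ g bs, Generated (fun b => b.2.1) (fun b => b.2.2) (some g) bs ∧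
      bs.map (fun b : κ × Bool × Bool => b.1) = w := by
  induction w using List.reverseRecOn with
  | nil => exact ⟨true, [], Generated.start, rfl⟩
  | append_singleton w a ih =>
    obtain ⟨g, bs, h1, h2⟩ := ih
    exact ⟨false, bs ++ [(a, g, false)], Generated.more (a, g, false) h1 rfl, by simp [h2]⟩

theorem exists_generated {w : List κ} (hw : w ≠ []) :
    ∃ bs, Generated (fun b => b.2.1) (fun b => b.2.2) none bs ∧
      bs.map (fun b : κ × Bool × Bool => b.1) = w := by
  obtain ⟨w, a, rfl⟩ := List.eq_nil_or_concat' w |>.resolve_left hw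
  obtain ⟨g, bs, h1, h2⟩ := exists_generated_some w
  exact ⟨bs ++ [(a, g, true)], Generated.done (a, g, true) h1 rfl, by simp [h2]⟩

end Pipeline

/-- The nonempty labels of the paths of a rational graph from a vertex to a regular language form a
context-sensitive language. -/
theorem RationalGraph.isContextSensitive_pathLanguage {α : Type*} [Finite α] {Γ : Type} [Finite Γ]
    (G : RationalGraph α Γ) (i : List Γ) {F : Language Γ} (hF : F.IsRegular) :
    Language.IsContextSensitive {w | w ∈ G.pathLanguage {i} F ∧ w ≠ []} := by
  obtain ⟨σ, _, M, rfl⟩ := hF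
  -- Nonterminals must live in `Type`, so the labels, from any universe, are coded in `Fin n`.
  obtain ⟨n, ⟨e⟩⟩ := Finite.exists_equiv_fin α
  have h := Pipeline.isContextSensitive (Pipeline.closedGraph G e.symm i M) (fun b => e.symm b.1)
    (fun b => b.2.1) (fun b => b.2.2)
  refine (congrArg Language.IsContextSensitive (Set.ext fun w => ?_)).mpr h
  constructor
  · rintro ⟨⟨s, hs, t, ht, hp⟩, hw⟩
    obtain rfl : s = i := hs
    obtain ⟨bs, h1, h2⟩ := Pipeline.exists_generated (w := w.map e) (by simpa using hw)
    have h3 : bs.map (fun b => e.symm b.1) = w := by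
      have := congrArg (List.map e.symm) h2
      simpa [Function.comp_def] using this
    refine ⟨bs, h1, h3, ?_⟩
    exact (h1.path_iff.2).2 ⟨t, ht, by rw [h3]; exact hp⟩
  · rintro ⟨bs, h1, rfl, h2⟩
    have := h1.path_iff (G := G) (lab := e.symm) (i := i) (M := M)
    obtain ⟨v, hv, hp⟩ := this.2.1 h2
    exact ⟨⟨i, rfl, v, hv, hp⟩, by simpa using this.1⟩

/-! ### Row automata and folded computations. -/

/-- A finite automaton that compares two rows of symbols, where `none` stands for a blank. -/
structure RowAutomaton (S : Type) where
  State : Type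
  finite_state : Finite State
  trans : State → Option S → Option S → State → Prop
  start : Set State
  accept : Set State

namespace RowAutomaton

variable {S : Type} {A : RowAutomaton S}

inductive Run (A : RowAutomaton S) : A.State → List (Option S) → List (Option S) → A.State → Prop
  | nil (p) : Run A p [] [] p
  | cons {p q r x x' X X'} : A.trans p x x' q → Run A q X X' r → Run A p (x :: X) (x' :: X') r

/-- The automaton accepts the pair of rows. -/
def Step (A : RowAutomaton S) (X X' : List (Option S)) : Prop :=
  ∃ p ∈ A.start, ∃ q ∈ A.accept, A.Run p X X' q

/-- The blank row is reached in exactly `n` steps. -/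
def BlanksIn (A : RowAutomaton S) : ℕ → List (Option S) → Prop
  | 0, X => ∀ x ∈ X, x = none
  | n + 1, X => ∃ X', A.Step X X' ∧ A.BlanksIn n X'

theorem Run.length_eq {p q : A.State} {X X' : List (Option S)} (h : A.Run p X X' q) :
    X'.length = X.length := by
  induction h with
  | nil => rfl
  | cons _ _ ih => simp [ih]

theorem Step.length_eq {X X' : List (Option S)} (h : A.Step X X') : X'.length = X.length := by
  obtain ⟨_, _, _, _, h⟩ := h
  exact h.length_eq

theorem run_cons_iff {p r : A.State} {x : Option S} {X Z : List (Option S)} :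
    A.Run p (x :: X) Z r ↔ ∃ x' X' q, Z = x' :: X' ∧ A.trans p x x' q ∧ A.Run q X X' r := by
  constructor
  · intro h; cases h with | cons h1 h2 => exact ⟨_, _, _, rfl, h1, h2⟩
  · rintro ⟨x', X', q, rfl, h1, h2⟩; exact Run.cons h1 h2

theorem run_nil_iff {p r : A.State} {Z : List (Option S)} : A.Run p [] Z r ↔ Z = [] ∧ p = r := by
  constructor
  · intro h; cases h; exact ⟨rfl, rfl⟩
  · rintro ⟨rfl, rfl⟩; exact Run.nil p

theorem run_append_iff {p r : A.State} {X Y Z : List (Option S)} :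
    A.Run p (X ++ Y) Z r ↔ ∃ X' Y' q, Z = X' ++ Y' ∧ A.Run p X X' q ∧ A.Run q Y Y' r := by
  induction X generalizing p Z with
  | nil =>
    simp only [List.nil_append, run_nil_iff]
    constructor
    · intro h; exact ⟨[], Z, p, rfl, ⟨rfl, rfl⟩, h⟩
    · rintro ⟨_, _, _, rfl, ⟨rfl, rfl⟩, h⟩; exact h
  | cons x X ih =>
    simp only [List.cons_append, run_cons_iff, ih]
    constructor
    · rintro ⟨x', _, q, rfl, h1, X', Y', r', rfl, h2, h3⟩
      exact ⟨x' :: X', Y', r', rfl, ⟨x', X', q, rfl, h1, h2⟩, h3⟩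
    · rintro ⟨_, Y', r', rfl, ⟨x', X', q, rfl, h1, h2⟩, h3⟩
      exact ⟨x', X' ++ Y', q, rfl, h1, X', Y', r', rfl, h2, h3⟩

theorem Run.append {p q r : A.State} {X X' Y Y' : List (Option S)} (h : A.Run p X X' q)
    (h' : A.Run q Y Y' r) : A.Run p (X ++ Y) (X' ++ Y') r :=
  run_append_iff.2 ⟨_, _, _, rfl, h, h'⟩

/-- A tape with left part `X` and right part `Y` becomes blank, where the automaton crosses the two
ends of the middle part in the pairs of states of the given column, one for each step. -/
inductive Folded (A : RowAutomaton S) :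
    List (A.State × A.State) → List (Option S) → List (Option S) → Prop
  | nil {X Y} : (∀ x ∈ X, x = none) → (∀ y ∈ Y, y = none) → Folded A [] X Y
  | cons {p q b f col X X' Y Y'} : p ∈ A.start → A.Run p X X' b → A.Run f Y Y' q → q ∈ A.accept →
      Folded A col X' Y' → Folded A ((b, f) :: col) X Y

/-- The contents `x`, `y` of two tape cells become blank, and lead from the first column of pairs of
states to the second. -/
inductive CellRun (A : RowAutomaton S) :
    Option S → Option S → List (A.State × A.State) → List (A.State × A.State) → Prop
  | nil : CellRun A none none [] []
  | cons {x x' y y' b b' f f' col col'} : A.trans b' x x' b → A.trans f y y' f' →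
      CellRun A x' y' col col' → CellRun A x y ((b, f) :: col) ((b', f') :: col')

theorem CellRun.length_eq {x y : Option S} {col col' : List (A.State × A.State)}
    (h : A.CellRun x y col col') : col'.length = col.length := by
  induction h with
  | nil => rfl
  | cons _ _ _ ih => simp [ih]

theorem CellRun.folded {x y : Option S} {col col' : List (A.State × A.State)}
    {X Y : List (Option S)} (h : A.CellRun x y col col') (h' : A.Folded col' X Y) :
    A.Folded col (X ++ [x]) (y :: Y) := by
  induction h generalizing X Y with
  | nil =>
    cases h' with
    | nil hX hY =>
      refine Folded.nil (fun x hx => ?_) (fun y hy => ?_)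
      · rcases List.mem_append.1 hx with hx | hx
        · exact hX x hx
        · simpa using hx
      · rcases List.mem_cons.1 hy with rfl | hy
        · rfl
        · exact hY y hy
  | cons h1 h2 _ ih =>
    cases h' with
    | cons hp hX hY hq hc =>
      exact Folded.cons hp (hX.append (Run.cons h1 (Run.nil _))) (Run.cons h2 hY) hq (ih hc)

/-- The two cells next to the middle part join it: at each step the crossing states move outwards by
one cell on both sides. -/
theorem Folded.exists_cellRun {x y : Option S} {col : List (A.State × A.State)}
    {X Y : List (Option S)} (h : A.Folded col (X ++ [x]) (y :: Y)) :
    ∃ col', A.CellRun x y col col' ∧ A.Folded col' X Y := by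
  induction col generalizing x y X Y with
  | nil =>
    cases h with
    | nil hX hY =>
      obtain rfl : x = none := hX x (by simp)
      obtain rfl : y = none := hY y (by simp)
      exact ⟨[], CellRun.nil, Folded.nil (fun x hx => hX x (by simp [hx]))
        (fun y hy => hY y (by simp [hy]))⟩
  | cons bf col ih =>
    cases h with
    | cons hp hX hY hq hc =>
      obtain ⟨X', Z, b', rfl, h1, h2⟩ := run_append_iff.1 hX
      obtain ⟨x', _, _, rfl, h3, h4⟩ := run_cons_iff.1 h2
      obtain ⟨rfl, rfl⟩ := run_nil_iff.1 h4
      obtain ⟨y', Y', f', rfl, h5, h6⟩ := run_cons_iff.1 hY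
      obtain ⟨col', hcol, hf⟩ := ih hc
      exact ⟨(b', f') :: col', CellRun.cons h3 h5 hcol, Folded.cons hp h1 h6 hq hf⟩

theorem folded_nil_iff {col : List (A.State × A.State)} :
    A.Folded col [] [] ↔ ∀ s ∈ col, s.1 ∈ A.start ∧ s.2 ∈ A.accept := by
  induction col with
  | nil => simpa using Folded.nil (by simp) (by simp)
  | cons s col ih =>
    rw [List.forall_mem_cons, ← ih]
    constructor
    · intro h
      cases h with
      | cons hp hX hY hq hc =>
        obtain ⟨rfl, rfl⟩ := run_nil_iff.1 hX
        obtain ⟨rfl, rfl⟩ := run_nil_iff.1 hY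
        exact ⟨⟨hp, hq⟩, hc⟩
    · rintro ⟨⟨hp, hq⟩, hc⟩
      exact Folded.cons hp (Run.nil _) (Run.nil _) hq hc

/-- Across an empty middle part the two crossing states coincide, so the half runs can be glued. -/
theorem Folded.blanksIn {col : List (A.State × A.State)} {X Y : List (Option S)}
    (h : A.Folded col X Y) (hd : ∀ s ∈ col, s.1 = s.2) : A.BlanksIn col.length (X ++ Y) := by
  induction h with
  | nil hX hY =>
    intro x hx
    rcases List.mem_append.1 hx with hx | hx
    · exact hX x hx
    · exact hY x hx
  | cons hp hX hY hq _ ih =>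
    have hbf := hd _ (List.mem_cons_self ..)
    dsimp only at hbf
    subst hbf
    exact ⟨_, ⟨_, hp, _, hq, hX.append hY⟩, ih fun s hs => hd s (List.mem_cons_of_mem _ hs)⟩

theorem BlanksIn.exists_folded {n : ℕ} {X Y : List (Option S)} (h : A.BlanksIn n (X ++ Y)) :
    ∃ col, col.length = n ∧ (∀ s ∈ col, s.1 = s.2) ∧ A.Folded col X Y := by
  induction n generalizing X Y with
  | zero =>
    exact ⟨[], rfl, by simp, Folded.nil (fun x hx => h x (by simp [hx]))
      (fun x hx => h x (by simp [hx]))⟩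
  | succ n ih =>
    obtain ⟨Z, ⟨p, hp, q, hq, hr⟩, hZ⟩ := h
    obtain ⟨X', Y', s, rfl, h1, h2⟩ := run_append_iff.1 hr
    obtain ⟨col, rfl, hd, hf⟩ := ih hZ
    refine ⟨(s, s) :: col, rfl, ?_, Folded.cons hp h1 h2 hq hf⟩
    simpa using hd

/-- The rows that can be made blank. -/
def Blanks (A : RowAutomaton S) (X : List (Option S)) : Prop := ∃ n, A.BlanksIn n X

theorem BlanksIn.mono {n m : ℕ} {X : List (Option S)} (hA : ∀ X, A.Step X X)
    (h : A.BlanksIn n X) (hnm : n ≤ m) : A.BlanksIn m X := by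
  induction m, hnm using Nat.le_induction with
  | base => exact h
  | succ m _ ih => exact ⟨X, hA X, ih⟩

/-- The bound is the number of rows of this length: a shortest computation visits distinct rows, and
idle steps fill up the time. -/
theorem Blanks.blanksIn [Finite S] {X : List (Option S)} (hA : ∀ X, A.Step X X)
    (h : A.Blanks X) : A.BlanksIn (Nat.card (Option S) ^ X.length) X := by
  classical
  have := Fintype.ofFinite S
  let V : Set (List (Option S)) := {Y | Y.length = X.length}
  have hVf : V.Finite := List.finite_length_eq (Option S) X.length
  have hV : V.ncard = Nat.card (Option S) ^ X.length := by
    have h1 : Nat.card (List.Vector (Option S) X.length) = _ := Nat.card_eq_fintype_card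
    rw [card_vector, ← Nat.card_eq_fintype_card] at h1
    exact h1
  let d : List (Option S) → ℕ := fun Y => sInf {n | A.BlanksIn n Y}
  -- Along a shortest computation the least number of steps falls by one each time, so all smaller
  -- values occur as well.
  have key : ∀ n Y, Y ∈ V → IsLeast {n | A.BlanksIn n Y} n → Set.Iic n ⊆ d '' V := by
    intro n
    induction n with
    | zero =>
      rintro Y hY hn k hk
      obtain rfl : k = 0 := by simpa using hk
      exact ⟨Y, hY, hn.csInf_eq⟩
    | succ n ih =>
      intro Y hY hn k hk
      rcases Nat.lt_or_ge n k with hlt | hle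
      · obtain rfl : k = n + 1 := le_antisymm hk hlt
        exact ⟨Y, hY, hn.csInf_eq⟩
      · obtain ⟨Y', hs, hY'⟩ := hn.1
        refine ih Y' (hs.length_eq.trans hY) ⟨hY', fun m hm => ?_⟩ hle
        exact Nat.succ_le_succ_iff.1 (hn.2 ⟨Y', hs, hm⟩)
  have hl : IsLeast {n | A.BlanksIn n X} (d X) := ⟨Nat.sInf_mem h, fun m hm => Nat.sInf_le hm⟩
  have h1 := Set.ncard_le_ncard (key (d X) X rfl hl) (hVf.image d)
  have h2 := h1.trans (Set.ncard_image_le hVf)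
  rw [hV, Set.ncard_eq_toFinset_card'] at h2
  simp at h2
  exact hl.1.mono hA (by rw [Nat.card_eq_fintype_card, Fintype.card_option]; omega)

end RowAutomaton

/-! ### The folded tape graph and its edges. -/

namespace RowAutomaton

variable {S : Type}

/-- The letters of the vertices of the folded tape graph: tape symbols, clock ticks, and pairs of
states. -/
inductive Letter (A : RowAutomaton S)
  | sym (d : S) : Letter A
  | tick : Letter A
  | pair (b f : A.State) : Letter A

/-- The states of the transducers of the folded tape graph. -/
inductive TapeState (S : Type) (c : ℕ)
  | init : TapeState S c
  | grow (j : Fin (c + 1)) : TapeState S c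
  | tape (x y : Option S) : TapeState S c

variable {A : RowAutomaton S} {c : ℕ}

/-- A tick may be read as any pair of equal states. -/
inductive Reads : Letter A → A.State × A.State → Prop
  | tick (q : A.State) : Reads Letter.tick (q, q)
  | pair (b f : A.State) : Reads (Letter.pair b f) (b, f)

/-- The transducer of the letter `s` either pushes `s` and multiplies the clock by `c`, or takes a
symbol from the stack (or a blank) and `s` as the contents of two tape cells, and passes a column of
pairs of states through them. -/
inductive TapeTrans (A : RowAutomaton S) (c : ℕ) (s : S) :
    TapeState S c → Option (Letter A) → Option (Letter A) → TapeState S c → Prop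
  | push : TapeTrans A c s .init none (some (.sym s)) (.grow 0)
  | pop (d : S) : TapeTrans A c s .init (some (.sym d)) none (.tape (some d) (some s))
  | hold : TapeTrans A c s .init none none (.tape none (some s))
  | copyGrow (d : S) : TapeTrans A c s (.grow 0) (some (.sym d)) (some (.sym d)) (.grow 0)
  | tick : TapeTrans A c s (.grow 0) (some .tick) none (.grow (Fin.last c))
  | emit (j : Fin c) : TapeTrans A c s (.grow j.succ) none (some .tick) (.grow j.castSucc)
  | copyTape (x y : Option S) (d : S) :
      TapeTrans A c s (.tape x y) (some (.sym d)) (some (.sym d)) (.tape x y)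
  | cell {x x' y y' : Option S} {l : Letter A} {b f b' f' : A.State} : Reads l (b, f) →
      A.trans b' x x' b → A.trans f y y' f' →
      TapeTrans A c s (.tape x y) (some l) (some (.pair b' f')) (.tape x' y')

variable (A c) in
/-- The transducer of the folded tape graph for the tape symbol `s`. -/
def tapeTransducer [Finite S] (s : S) : Transducer (Letter A) where
  State := TapeState S c
  finite_state := by
    refine Finite.of_injective (β := Unit ⊕ Fin (c + 1) ⊕ Option S × Option S)
      (fun | .init => .inl () | .grow j => .inr (.inl j) | .tape x y => .inr (.inr (x, y))) ?_
    rintro (_ | _ | _) (_ | _ | _) h <;> simp_all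
  init := .init
  final := {.grow 0, .tape none none}
  trans := {t | TapeTrans A c s t.1 t.2.1.1 t.2.1.2 t.2.2}

theorem finite_letter [Finite S] : Finite (Letter A) := by
  have := A.finite_state
  refine Finite.of_injective (β := Unit ⊕ S ⊕ A.State × A.State)
    (fun | .tick => .inl () | .sym j => .inr (.inl j) | .pair x y => .inr (.inr (x, y))) ?_
  rintro (_ | _ | _) (_ | _ | _) h <;> simp_all

/-- The output that a state may still produce without reading. -/
def TapeState.credit : TapeState S c → ℕ
  | .init => 1
  | .grow j => j
  | .tape _ _ => 0

/-- The output of the pushing mode. -/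
def growLetter (c : ℕ) : Letter A → List (Letter A)
  | .sym d => [.sym d]
  | .tick => List.replicate c .tick
  | .pair _ _ => []

theorem flatMap_growLetter_sym (Q : List S) :
    (Q.map .sym).flatMap (growLetter (A := A) c) = Q.map .sym := by
  induction Q with
  | nil => rfl
  | cons d Q ih => rw [List.map_cons, List.flatMap_cons, ih]; rfl

theorem flatMap_growLetter_tick (h : ℕ) : (List.replicate h .tick).flatMap
    (growLetter (A := A) c) = List.replicate (h * c) .tick := by
  induction h with
  | zero => simp
  | succ h ih =>
    rw [List.replicate_succ, List.flatMap_cons, ih, Nat.succ_mul, Nat.add_comm _ c,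
      List.replicate_add c]
    rfl

variable [Finite S]

/-- Writing without reading uses up credit, and only reading a tick raises it, to `c`. This bound
yields finite out-degree. -/
theorem length_le_of_run {s : S} {q q' : (tapeTransducer A c s).State} {u v : List (Letter A)}
    (h : (tapeTransducer A c s).Run q u v q') : v.length ≤ TapeState.credit q + (c + 1) * u.length := by
  induction h with
  | nil => simp
  | cons ht _ ih =>
    cases ht with
    | emit j => simp [TapeState.credit] at ih ⊢; omega
    | _ => simp [TapeState.credit, mul_add] at ih ⊢; try omega

/-- The pushing mode is deterministic and cannot read a pair, so no push is possible once folding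
has begun. -/
theorem growRun_sound {s : S} {q q' : (tapeTransducer A c s).State} {u v : List (Letter A)}
    (h : (tapeTransducer A c s).Run q u v q') (hq' : q' ∈ (tapeTransducer A c s).final)
    {j : Fin (c + 1)} (hq : q = .grow j) :
    (∀ b f, .pair b f ∉ u) ∧ v = List.replicate j .tick ++ u.flatMap (growLetter c) := by
  induction h generalizing j with
  | nil =>
    subst hq
    rcases hq' with hq' | hq'
    · obtain rfl : j = 0 := by simpa using hq'
      simp
    · cases hq'
  | cons ht _ ih =>
    subst hq
    cases ht with
    | copyGrow d =>
      obtain ⟨h1, h2⟩ := ih hq' rfl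
      simp [h1, h2, growLetter]
    | tick =>
      obtain ⟨h1, h2⟩ := ih hq' rfl
      simp [h1, h2, growLetter]
    | emit j =>
      obtain ⟨h1, h2⟩ := ih hq' rfl
      simp [h2, h1, List.replicate_succ]

theorem growRun_emit (s : S) (j : ℕ) (hj : j < c + 1) : (tapeTransducer A c s).Run
    (.grow ⟨j, hj⟩) [] (List.replicate j .tick) (.grow 0) := by
  induction j with
  | zero => exact Transducer.Run.nil _
  | succ j ih =>
    exact Transducer.Run.cons (T := tapeTransducer A c s) (x := none) (y := some .tick)
      (TapeTrans.emit ⟨j, by omega⟩) (ih (by omega))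

theorem growRun_complete (s : S) (Q : List S) (h : ℕ) : (tapeTransducer A c s).Run (.grow 0)
    (Q.map .sym ++ List.replicate h .tick) (Q.map .sym ++ List.replicate (h * c) .tick)
    (.grow 0) := by
  induction Q with
  | nil =>
    induction h with
    | zero => simpa using Transducer.Run.nil (T := tapeTransducer A c s) (.grow 0)
    | succ h ih =>
      have h1 := (growRun_emit (A := A) s c (Nat.lt_succ_self c)).append ih
      have h2 := Transducer.Run.cons (T := tapeTransducer A c s) (x := some .tick) (y := none)
        TapeTrans.tick h1
      rw [Nat.succ_mul, Nat.add_comm _ c, List.replicate_add c]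
      exact h2
  | cons d Q ih =>
    exact Transducer.Run.cons (T := tapeTransducer A c s) (x := some (.sym d))
      (y := some (.sym d)) (TapeTrans.copyGrow d) ih

/-- The letters of a column of pairs of states. -/
def columnLetters (col : List (A.State × A.State)) : List (Letter A) :=
  col.map fun s => .pair s.1 s.2

/-- The stack is copied while the two cell contents stay fixed; each later letter is one time step
of both cells. Ending in blank contents is the base case of `CellRun`. -/
theorem tapeRun_sound {s : S} {q q' : (tapeTransducer A c s).State} {u v : List (Letter A)}
    (h : (tapeTransducer A c s).Run q u v q') (hq' : q' ∈ (tapeTransducer A c s).final)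
    {x y : Option S} (hq : q = .tape x y) {Q : List S} {z : List (Letter A)}
    (hu : u = Q.map .sym ++ z) (hz : ∀ d, .sym d ∉ z) :
    ∃ col col', List.Forall₂ Reads z col ∧ A.CellRun x y col col' ∧
      v = Q.map .sym ++ columnLetters col' := by
  induction h generalizing x y Q z with
  | nil =>
    subst hq
    obtain ⟨h1, rfl⟩ := List.append_eq_nil_iff.1 hu.symm
    obtain rfl := List.map_eq_nil_iff.1 h1
    rcases hq' with hq' | hq'
    · cases hq'
    · obtain ⟨rfl, rfl⟩ : x = none ∧ y = none := by simpa using hq'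
      exact ⟨[], [], List.Forall₂.nil, CellRun.nil, rfl⟩
  | cons ht _ ih =>
    subst hq
    cases ht with
    | copyTape _ _ d =>
      cases Q with
      | nil => exact absurd (by rw [← show _ = z from hu]; simp) (hz d)
      | cons e Q =>
        simp only [Option.toList_some, List.map_cons, List.cons_append,
          List.cons.injEq, Letter.sym.injEq] at hu
        obtain ⟨rfl, hu⟩ := hu
        obtain ⟨col, col', h1, h2, rfl⟩ := ih hq' rfl hu hz
        exact ⟨col, col', h1, h2, rfl⟩
    | cell hl h1 h2 =>
      cases Q with
      | nil =>
        obtain rfl : _ = z := hu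
        obtain ⟨col, col', h3, h4, rfl⟩ := ih hq' rfl (Q := []) rfl fun d hd => hz d (by simp [hd])
        exact ⟨_ :: col, _ :: col', List.Forall₂.cons hl h3, CellRun.cons h1 h2 h4, rfl⟩
      | cons e Q =>
        simp only [Option.toList_some, List.map_cons, List.cons_append,
          List.cons.injEq] at hu
        obtain ⟨rfl, hu⟩ := hu
        cases hl

theorem tapeRun_complete (s : S) {x y : Option S} {col col' : List (A.State × A.State)}
    {z : List (Letter A)} (hz : List.Forall₂ Reads z col) (h : A.CellRun x y col col') (Q : List S) :
    (tapeTransducer A c s).Run (.tape x y) (Q.map .sym ++ z) (Q.map .sym ++ columnLetters col')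
      (.tape none none) := by
  induction Q with
  | nil =>
    induction h generalizing z with
    | nil => cases hz; exact Transducer.Run.nil _
    | cons h1 h2 _ ih =>
      cases hz with
      | cons hl hz =>
        exact Transducer.Run.cons (T := tapeTransducer A c s) (x := some _) (y := some _)
          (TapeTrans.cell hl h1 h2) (ih hz)
  | cons d Q ih =>
    exact Transducer.Run.cons (T := tapeTransducer A c s) (x := some (.sym d))
      (y := some (.sym d)) (TapeTrans.copyTape x y d) ih

variable {α : Type*} (code : α → S)

variable (A c) in
/-- The folded tape graph. -/
def tapeGraph : RationalGraph α (Letter A) := ⟨fun a => tapeTransducer A c (code a)⟩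

theorem tapeGraph_finiteOutDegree [Finite α] : (tapeGraph A c code).FiniteOutDegree := by
  intro u
  have := finite_letter (A := A)
  refine (Set.finite_univ.prod (List.finite_length_le (Letter A) (1 + (c + 1) * u.length))).subset ?_
  rintro ⟨a, v⟩ ⟨q, _, hr⟩
  exact ⟨trivial, length_le_of_run hr⟩

variable {code}

theorem tapeGraph_edge_sound {a : α} {Q : List S} {z v : List (Letter A)} (hz : ∀ d, .sym d ∉ z)
    (h : (tapeGraph A c code).Edge (Q.map .sym ++ z) a v) :
    ((∀ b f, .pair b f ∉ z) ∧
        v = (code a :: Q).map .sym ++ z.flatMap (growLetter c)) ∨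
      ∃ (d : Option S) (Q' : List S) (col col' : List (A.State × A.State)), Q = d.toList ++ Q' ∧
        List.Forall₂ Reads z col ∧ A.CellRun d (some (code a)) col col' ∧
        v = Q'.map .sym ++ columnLetters col' := by
  obtain ⟨q, hq, hr⟩ := h
  generalize hu : Q.map .sym ++ z = u at hr
  rcases hr.cases_head with ⟨rfl, -, -⟩ | ⟨x, y, r, u', v', ht, rfl, rfl, hr⟩
  · rcases hq with hq | hq <;> cases hq
  · cases ht with
    | push =>
      left
      rw [Option.toList_none, List.nil_append] at hu
      subst hu
      obtain ⟨h1, rfl⟩ := growRun_sound hr hq rfl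
      refine ⟨fun b f h => h1 b f (by simp [h]), ?_⟩
      simp [flatMap_growLetter_sym]
    | pop d =>
      right
      cases Q with
      | nil => exact absurd (by rw [show z = _ from hu]; simp) (hz d)
      | cons e Q =>
        simp only [Option.toList_some, List.map_cons, List.cons_append,
          List.cons.injEq, Letter.sym.injEq] at hu
        obtain ⟨rfl, hu⟩ := hu
        obtain ⟨col, col', h1, h2, rfl⟩ := tapeRun_sound hr hq rfl hu.symm hz
        exact ⟨some e, Q, col, col', rfl, h1, h2, rfl⟩
    | hold =>
      right
      obtain ⟨col, col', h1, h2, rfl⟩ := tapeRun_sound hr hq rfl hu.symm hz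
      exact ⟨none, Q, col, col', rfl, h1, h2, rfl⟩

theorem tapeGraph_edge_push (a : α) (Q : List S) (h : ℕ) :
    (tapeGraph A c code).Edge (Q.map .sym ++ List.replicate h .tick) a
      ((code a :: Q).map .sym ++ List.replicate (h * c) .tick) :=
  ⟨.grow 0, Or.inl rfl, Transducer.Run.cons (T := tapeTransducer A c (code a)) (x := none)
    (y := some _) TapeTrans.push (growRun_complete (code a) Q h)⟩

theorem tapeGraph_edge_fold (a : α) (d : Option S) (Q : List S) {z : List (Letter A)}
    {col col' : List (A.State × A.State)} (hz : List.Forall₂ Reads z col)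
    (h : A.CellRun d (some (code a)) col col') :
    (tapeGraph A c code).Edge ((d.toList ++ Q).map .sym ++ z) a
      (Q.map .sym ++ columnLetters col') := by
  refine ⟨.tape none none, Or.inr rfl, ?_⟩
  have hr := tapeRun_complete (c := c) (code a) hz h Q
  cases d with
  | none =>
    exact Transducer.Run.cons (T := tapeTransducer A c (code a)) (x := none)
      (y := none) TapeTrans.hold hr
  | some d =>
    exact Transducer.Run.cons (T := tapeTransducer A c (code a)) (x := some _)
      (y := none) (TapeTrans.pop d) hr

end RowAutomaton

/-! ### Final vertices and the path language of the folded tape graph. -/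

/-- The words all of whose letters satisfy a predicate form a regular language. -/
theorem Language.isRegular_forall_mem {T : Type*} (P : T → Prop) :
    Language.IsRegular {w : List T | ∀ l ∈ w, P l} := by
  classical
  let M : DFA T Bool := ⟨fun s l => s && decide (P l), true, {true}⟩
  refine ⟨Bool, inferInstance, M, ?_⟩
  have h : ∀ (w : List T) s, M.evalFrom s w = true ↔ s = true ∧ ∀ l ∈ w, P l := by
    intro w
    induction w with
    | nil => simp
    | cons a w ih =>
      intro s
      rw [DFA.evalFrom_cons, ih]
      simp [M, and_assoc]
  ext w
  exact (h w true).trans (by simp; rfl)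

namespace RowAutomaton

variable {S : Type} {A : RowAutomaton S} {c : ℕ}

/-- The letters allowed in final vertices. -/
def FinalLetter (A : RowAutomaton S) (ε : Prop) : Letter A → Prop
  | .sym _ => False
  | .tick => ε
  | .pair b f => b ∈ A.start ∧ f ∈ A.accept

/-- The final vertices of the folded tape graph. -/
def finalVertices (A : RowAutomaton S) (ε : Prop) : Language (Letter A) :=
  {v | ∀ l ∈ v, A.FinalLetter ε l}

theorem columnLetters_mem_finalVertices {ε : Prop} {Q : List S} {col : List (A.State × A.State)} :
    Q.map .sym ++ columnLetters col ∈ A.finalVertices ε ↔ Q = [] ∧ A.Folded col [] [] := by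
  rw [folded_nil_iff]
  change (∀ l ∈ _, _) ↔ _
  constructor
  · intro h
    constructor
    · cases Q with
      | nil => rfl
      | cons d Q => exact (h (.sym d) (by simp)).elim
    · intro s hs
      exact h (.pair s.1 s.2) (List.mem_append_right _ (List.mem_map_of_mem hs))
  · rintro ⟨rfl, h⟩ l hl
    obtain ⟨s, hs, rfl⟩ := List.mem_map.1 (show l ∈ columnLetters col from hl)
    exact h s hs

theorem tick_mem_finalVertices {ε : Prop} {Q : List S} {h : ℕ} (hh : h ≠ 0) :
    Q.map .sym ++ List.replicate h .tick ∈ A.finalVertices ε ↔ Q = [] ∧ ε := by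
  change (∀ l ∈ _, _) ↔ _
  constructor
  · intro hl
    constructor
    · cases Q with
      | nil => rfl
      | cons d Q => exact (hl (.sym d) (by simp)).elim
    · exact hl .tick (by simp [hh])
  · rintro ⟨rfl, h⟩ l hl
    obtain rfl : l = .tick := by
      rw [List.map_nil, List.nil_append] at hl
      exact List.eq_of_mem_replicate hl
    exact h

theorem sym_not_mem_columnLetters {col : List (A.State × A.State)} (d : S) :
    .sym d ∉ columnLetters col := by
  simp [columnLetters]

theorem forall₂_reads_columnLetters {col col' : List (A.State × A.State)} :
    List.Forall₂ Reads (columnLetters col) col' ↔ col' = col := by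
  constructor
  · induction col generalizing col' with
    | nil => intro h; cases h; rfl
    | cons s col ih =>
      intro h
      cases h with
      | cons h1 h2 =>
        rw [ih h2]
        cases h1
        rfl
  · rintro rfl
    induction col' with
    | nil => exact List.Forall₂.nil
    | cons s col ih => exact List.Forall₂.cons (Reads.pair _ _) ih

theorem forall₂_reads_tick {h : ℕ} {col : List (A.State × A.State)} :
    List.Forall₂ Reads (List.replicate h .tick) col ↔ col.length = h ∧ ∀ s ∈ col, s.1 = s.2 := by
  induction h generalizing col with
  | zero =>
    cases col <;> simp
  | succ h ih =>
    cases col with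
    | nil => simp [List.replicate_succ]
    | cons s col =>
      obtain ⟨b, f⟩ := s
      rw [List.replicate_succ, List.forall₂_cons, ih]
      have : Reads (A := A) .tick (b, f) ↔ b = f := by
        constructor
        · intro h; cases h; rfl
        · rintro rfl; exact Reads.tick b
      simp only [this, List.length_cons, Nat.succ_inj, List.forall_mem_cons]
      tauto

variable [Finite S] {α : Type*} {code : α → S} {ε : Prop}

/-- Read backwards from a final vertex, where no tape remains outside, each edge restores its two
cells beside the middle. The column keeps its length, so it stays nonempty and blocks every push. -/
theorem folded_of_path {Q : List S} {col : List (A.State × A.State)} {w : List α}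
    {v : List (Letter A)} (hcol : col ≠ []) (hv : v ∈ A.finalVertices ε)
    (h : (tapeGraph A c code).Path (Q.map .sym ++ columnLetters col) w v) :
    ∃ X Y, A.Folded col X Y ∧ X.reduceOption = Q.reverse ∧ Y.reduceOption = w.map code := by
  induction w generalizing Q col with
  | nil =>
    obtain rfl := RationalGraph.path_nil_iff.1 h
    obtain ⟨rfl, hf⟩ := columnLetters_mem_finalVertices.1 hv
    exact ⟨[], [], hf, rfl, rfl⟩
  | cons a w ih =>
    obtain ⟨u, he, hp⟩ := RationalGraph.path_cons_iff.1 h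
    rcases tapeGraph_edge_sound sym_not_mem_columnLetters he with
      ⟨h1, -⟩ | ⟨d, Q', col₁, col', rfl, h1, h2, rfl⟩
    · cases col with
      | nil => exact absurd rfl hcol
      | cons s col => exact absurd (by simp [columnLetters]) (h1 s.1 s.2)
    · obtain rfl := forall₂_reads_columnLetters.1 h1
      have hcol' : col' ≠ [] := by
        intro h; have := h2.length_eq; rw [h] at this
        exact hcol (List.eq_nil_of_length_eq_zero this.symm)
      obtain ⟨X, Y, h3, h4, h5⟩ := ih hcol' hp
      refine ⟨X ++ [d], some (code a) :: Y, h2.folded h3, ?_, by simp [h5]⟩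
      cases d <;> simp [List.reduceOption_append, h4]

/-- The first folding edge turns ticks into diagonal pairs, so the halves glue wherever the path
chose to fold. A nonzero clock is needed because the empty clock and the empty column are the same
word. -/
theorem blanks_of_path {Q : List S} {h : ℕ} {w : List α} {v : List (Letter A)} (hc : c ≠ 0)
    (hh : h ≠ 0) (hv : v ∈ A.finalVertices ε)
    (hp : (tapeGraph A c code).Path (Q.map .sym ++ List.replicate h .tick) w v) :
    (w = [] ∧ Q = [] ∧ ε) ∨
      (w ≠ [] ∧ ∃ X, A.Blanks X ∧ X.reduceOption = Q.reverse ++ w.map code) := by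
  induction w generalizing Q h with
  | nil =>
    obtain rfl := RationalGraph.path_nil_iff.1 hp
    exact Or.inl ⟨rfl, (tick_mem_finalVertices hh).1 hv⟩
  | cons a w ih =>
    right
    refine ⟨by simp, ?_⟩
    obtain ⟨u, he, hp'⟩ := RationalGraph.path_cons_iff.1 hp
    rcases tapeGraph_edge_sound (by simp) he with
      ⟨-, rfl⟩ | ⟨d, Q', col, col', rfl, h1, h2, rfl⟩
    · rw [flatMap_growLetter_tick] at hp'
      rcases ih (Nat.mul_ne_zero hh hc) hp' with ⟨-, h1, -⟩ | ⟨-, X, h1, h2⟩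
      · simp at h1
      · exact ⟨X, h1, by simp [h2]⟩
    · obtain ⟨rfl, hd⟩ := forall₂_reads_tick.1 h1
      have hcol' : col' ≠ [] := by
        rintro rfl
        exact hh h2.length_eq.symm
      obtain ⟨X, Y, h3, h4, h5⟩ := folded_of_path hcol' hv hp'
      refine ⟨(X ++ [d]) ++ some (code a) :: Y, ⟨_, (h2.folded h3).blanksIn hd⟩, ?_⟩
      cases d <;> simp [List.reduceOption_append, h4, h5]

theorem Folded.exists_path {X Y : List (Option S)} {col : List (A.State × A.State)} {w : List α}
    (h : A.Folded col X Y) (hY : Y = w.map fun a => some (code a)) (hXY : X.length = Y.length) :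
    ∃ v ∈ A.finalVertices ε, (tapeGraph A c code).Path
      (X.reduceOption.reverse.map .sym ++ columnLetters col) w v := by
  induction w generalizing X Y col with
  | nil =>
    subst hY
    obtain rfl := List.eq_nil_of_length_eq_zero hXY
    exact ⟨_, columnLetters_mem_finalVertices.2 ⟨rfl, h⟩, RationalGraph.Path.nil _⟩
  | cons a w ih =>
    subst hY
    obtain rfl | ⟨X, d, rfl⟩ := List.eq_nil_or_concat' X
    · simp at hXY
    · obtain ⟨col', h1, h2⟩ := h.exists_cellRun
      obtain ⟨v, hv, hp⟩ := ih h2 rfl (by simpa using hXY)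
      refine ⟨v, hv, RationalGraph.Path.cons (u' := _) ?_ hp⟩
      have he := tapeGraph_edge_fold (c := c) a d X.reduceOption.reverse
        (forall₂_reads_columnLetters.2 rfl) h1
      cases d <;> simpa [List.reduceOption_append] using he

theorem tapeGraph_path_push (w : List α) (Q : List S) (h : ℕ) :
    (tapeGraph A c code).Path (Q.map .sym ++ List.replicate h .tick) w
      (((w.map code).reverse ++ Q).map .sym ++ List.replicate (h * c ^ w.length) .tick) := by
  induction w generalizing Q h with
  | nil => simpa using RationalGraph.Path.nil _
  | cons a w ih =>
    refine RationalGraph.Path.cons (tapeGraph_edge_push a Q h) ?_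
    have := ih (code a :: Q) (h * c)
    rw [List.length_cons, pow_succ', ← mul_assoc]
    simpa using this

theorem BlanksIn.exists_path {n : ℕ} {X : List (Option S)} {d : Option S} {a : α} {w : List α}
    (hX : X.length = w.length)
    (h : A.BlanksIn n (X ++ [d] ++ (a :: w).map fun a => some (code a))) :
    ∃ v ∈ A.finalVertices ε, (tapeGraph A c code).Path
      ((X ++ [d]).reduceOption.reverse.map .sym ++ List.replicate n .tick) (a :: w) v := by
  obtain ⟨col, hn, hd, hf⟩ := h.exists_folded
  obtain ⟨col', h1, h2⟩ := hf.exists_cellRun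
  obtain ⟨v, hv, hp⟩ := h2.exists_path (ε := ε) (c := c) rfl (by simpa using hX)
  refine ⟨v, hv, RationalGraph.Path.cons (u' := _) ?_ hp⟩
  have he := tapeGraph_edge_fold (c := c) a d X.reduceOption.reverse
    (forall₂_reads_tick.2 ⟨hn, hd⟩) h1
  cases d <;> simpa [List.reduceOption_append] using he

/-- A nonempty word is the concatenation of two words, where the second is as long as the first or
longer by one letter. -/
theorem exists_halves {w : List α} (hw : w ≠ []) : ∃ w₁ a w₂ k, w = w₁ ++ a :: w₂ ∧
    k + w₁.length = w₂.length + 1 ∧ k ≤ 1 := by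
  have h0 : 0 < w.length := List.length_pos_iff.2 hw
  have h1 : w.length / 2 < w.length := by omega
  refine ⟨w.take (w.length / 2), w[w.length / 2], w.drop (w.length / 2 + 1),
    w.length % 2, ?_, ?_, ?_⟩
  · rw [← List.drop_eq_getElem_cons h1, List.take_append_drop]
  · rw [List.length_take, List.length_drop]; omega
  · omega

/-- The path language of the folded tape graph, when an automaton that can stay idle makes a row
blank if and only if the nonblank symbols of the row satisfy `P`. -/
theorem tapeGraph_mem_pathLanguage {P : List S → Prop} (hA : ∀ X, A.Step X X)
    (hP : ∀ X, A.Blanks X ↔ P X.reduceOption) (hc : c = Nat.card (Option S) ^ 2) {w : List α} :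
    w ∈ (tapeGraph A c code).pathLanguage {List.replicate c .tick} (A.finalVertices ε) ↔
      (w = [] ∧ ε) ∨ (w ≠ [] ∧ P (w.map code)) := by
  have hK : 0 < Nat.card (Option S) := Nat.card_pos
  have hc0 : c ≠ 0 := by rw [hc]; positivity
  constructor
  · rintro ⟨s, rfl, v, hv, hp⟩
    rcases blanks_of_path (Q := []) hc0 hc0 hv hp with ⟨rfl, -, h⟩ | ⟨hw, X, h1, h2⟩
    · exact Or.inl ⟨rfl, h⟩
    · refine Or.inr ⟨hw, ?_⟩
      rw [hP, h2] at h1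
      simpa using h1
  · rintro (⟨rfl, h⟩ | ⟨hw, h⟩)
    · exact ⟨_, rfl, _, (tick_mem_finalVertices (Q := []) hc0).2 ⟨rfl, h⟩, RationalGraph.Path.nil _⟩
    · obtain ⟨w₁, a, w₂, k, rfl, h1, h2⟩ := exists_halves hw
      -- If the length is odd, a blank at the far left makes the halves equal; it is folded last,
      -- when the stack is empty.
      obtain ⟨X, d, hXd⟩ := (List.eq_nil_or_concat'
        (List.replicate k none ++ w₁.map fun a => some (code a))).resolve_left
          (by rw [← ne_eq, ← List.length_pos_iff]; simp; omega)
      have hlen : X.length + 1 = k + w₁.length := by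
        have := congrArg List.length hXd
        simp at this; omega
      have hred : (X ++ [d]).reduceOption = w₁.map code := by
        rw [← hXd, List.reduceOption_append, List.reduceOption_replicate_none]
        simp [List.reduceOption]
      have hb : A.Blanks (X ++ [d] ++ (a :: w₂).map fun a => some (code a)) := by
        rw [hP, List.reduceOption_append, hred]
        rw [List.map_append] at h
        have : ((a :: w₂).map fun a => some (code a)).reduceOption = (a :: w₂).map code := by
          simp [List.reduceOption]
        rwa [this]
      have hn := hb.blanksIn hA
      -- The row has length `2 * (k + w₁.length)`, at most `2 * (w₁.length + 1)`. This is why `c` is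
      -- a square and why the clock starts at `c` rather than at 1.
      have hle : Nat.card (Option S) ^
          (X ++ [d] ++ (a :: w₂).map fun a => some (code a)).length ≤ c * c ^ w₁.length := by
        rw [hc, ← pow_succ', ← pow_mul]
        refine Nat.pow_le_pow_right hK ?_
        simp
        omega
      obtain ⟨v, hv, hp⟩ := (hn.mono hA hle).exists_path (ε := ε) (c := c) (by omega)
      refine ⟨_, rfl, v, hv, ?_⟩
      have hp' := tapeGraph_path_push (A := A) (c := c) (code := code) w₁ [] c
      rw [hred] at hp
      rw [List.append_nil] at hp'
      exact hp'.append hp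

end RowAutomaton

/-! ### An automaton for reversed derivation steps -/

namespace Rewriting

variable {S : Type}

/-- A pattern: a word of symbols to read, with what takes the place of each of them. -/
abbrev Pattern (S : Type) := List (S × Option S)

/-- The word that the pattern replaces. -/
def Pattern.input (l : Pattern S) : List S := l.map Prod.fst

/-- The word that the pattern writes. -/
def Pattern.output (l : Pattern S) : List S := (l.map Prod.snd).reduceOption

/-- The states of the pattern automaton: it copies before the place of the rewriting, or it is
inside a pattern at this place, or inside a pattern for the whole row. -/
inductive State (S : Type) (N : ℕ)
  | copy : State S N
  | mid (l : {l : Pattern S // l.length ≤ N}) : State S N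
  | full (l : {l : Pattern S // l.length ≤ N}) : State S N

variable {N : ℕ}

inductive Trans (R : Set (Pattern S)) :
    State S N → Option S → Option S → State S N → Prop
  | copy (x) : Trans R .copy x x .copy
  | enter {s o l} : (s, o) :: l.1 ∈ R → Trans R .copy (some s) o (.mid l)
  | midSkip {l} : Trans R (.mid l) none none (.mid l)
  | midRead {s o l l'} : l.1 = (s, o) :: l'.1 → Trans R (.mid l) (some s) o (.mid l')
  | midDone {l x} : l.1 = [] → Trans R (.mid l) x x (.mid l)
  | fullSkip {l} : Trans R (.full l) none none (.full l)
  | fullRead {s o l l'} : l.1 = (s, o) :: l'.1 → Trans R (.full l) (some s) o (.full l')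

/-- The automaton for the rewriting of a pattern of `R` somewhere in a row, or of the pattern `e`
for the whole row. -/
def patternAutomaton [Finite S] (R : Set (Pattern S)) (e : Pattern S) (N : ℕ) :
    RowAutomaton S where
  State := State S N
  finite_state := by
    have : Finite {l : Pattern S // l.length ≤ N} := List.finite_length_le (S × Option S) N
    refine Finite.of_injective (β := Unit ⊕ {l : Pattern S // l.length ≤ N} ⊕
      {l : Pattern S // l.length ≤ N})
      (fun | .copy => .inl () | .mid l => .inr (.inl l) | .full l => .inr (.inr l)) ?_
    rintro (_ | _ | _) (_ | _ | _) h <;> simp_all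
  trans := Trans R
  start := {q | q = .copy ∨ ∃ l, q = .full l ∧ l.1 = e}
  accept := {q | q = .copy ∨ ∃ l, (q = .mid l ∨ q = .full l) ∧ l.1 = []}

variable [Finite S] {R : Set (Pattern S)} {e : Pattern S}

/-- The word `z` is what is copied once the pattern is used up. Blanks may be interspersed among the
symbols that the pattern reads. -/
theorem mid_sound {X X' : List (Option S)} {p q : (patternAutomaton R e N).State}
    (h : (patternAutomaton R e N).Run p X X' q) (hq : q ∈ (patternAutomaton R e N).accept)
    {l : {l : Pattern S // l.length ≤ N}} (hp : p = State.mid l) :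
    ∃ z, X.reduceOption = l.1.input ++ z ∧ X'.reduceOption = l.1.output ++ z := by
  induction h generalizing l with
  | nil =>
    subst hp
    rcases hq with hq | ⟨l', hq | hq, hl⟩
    · cases hq
    · cases hq
      exact ⟨[], by simp [hl, Pattern.input], by simp [hl, Pattern.output]⟩
    · cases hq
  | @cons p q r x x' X X' ht _ ih =>
    subst hp
    cases ht with
    | midSkip => simpa using ih hq rfl
    | midRead hl =>
      obtain ⟨z, h1, h2⟩ := ih hq rfl
      refine ⟨z, by simp [h1, hl, Pattern.input], ?_⟩
      cases x' <;> simp [h2, hl, Pattern.output]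
    | midDone hl =>
      obtain ⟨z, h1, h2⟩ := ih hq rfl
      simp only [hl, Pattern.input, Pattern.output, List.map_nil, List.reduceOption_nil,
        List.nil_append] at h1 h2 ⊢
      refine ⟨_, rfl, ?_⟩
      cases x <;> simp [h1, h2]

theorem full_sound {X X' : List (Option S)} {p q : (patternAutomaton R e N).State}
    (h : (patternAutomaton R e N).Run p X X' q) (hq : q ∈ (patternAutomaton R e N).accept)
    {l : {l : Pattern S // l.length ≤ N}} (hp : p = State.full l) :
    X.reduceOption = l.1.input ∧ X'.reduceOption = l.1.output := by
  induction h generalizing l with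
  | nil =>
    subst hp
    rcases hq with hq | ⟨l', hq | hq, hl⟩
    · cases hq
    · cases hq
    · cases hq
      exact ⟨by simp [hl, Pattern.input], by simp [hl, Pattern.output]⟩
  | @cons p q r x x' X X' ht _ ih =>
    subst hp
    cases ht with
    | fullSkip => simpa using ih hq rfl
    | fullRead hl =>
      obtain ⟨h1, h2⟩ := ih hq rfl
      refine ⟨by simp [h1, hl, Pattern.input], ?_⟩
      cases x' <;> simp [h2, hl, Pattern.output]

/-- The words before and after a step of the pattern automaton. -/
def Rewrite (R : Set (Pattern S)) (e : Pattern S) (x y : List S) : Prop :=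
  x = y ∨ (∃ l ∈ R, ∃ p z, x = p ++ (l.input ++ z) ∧ y = p ++ (l.output ++ z)) ∨
    x = e.input ∧ y = e.output

theorem copy_sound {X X' : List (Option S)} {p q : (patternAutomaton R e N).State}
    (h : (patternAutomaton R e N).Run p X X' q) (hq : q ∈ (patternAutomaton R e N).accept)
    (hp : p = State.copy) : X.reduceOption = X'.reduceOption ∨
      ∃ l ∈ R, ∃ p z, X.reduceOption = p ++ (l.input ++ z) ∧
        X'.reduceOption = p ++ (l.output ++ z) := by
  induction h with
  | nil => exact Or.inl rfl
  | @cons p q r x x' X X' ht hr ih =>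
    subst hp
    cases ht with
    | copy =>
      rcases ih hq rfl with h | ⟨l, hl, p, z, h1, h2⟩
      · left; cases x <;> simp [h]
      · right
        refine ⟨l, hl, x.toList ++ p, z, ?_, ?_⟩ <;> cases x <;> simp [h1, h2]
    | enter hl =>
      right
      obtain ⟨z, h1, h2⟩ := mid_sound hr hq rfl
      refine ⟨_, hl, [], z, by simp [h1, Pattern.input], ?_⟩
      cases x' <;> simp [h2, Pattern.output]

theorem step_sound {X X' : List (Option S)} (h : (patternAutomaton R e N).Step X X') :
    Rewrite R e X.reduceOption X'.reduceOption := by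
  obtain ⟨p, hp, q, hq, hr⟩ := h
  rcases hp with hp | ⟨l, hp, rfl⟩
  · rcases copy_sound hr hq hp with h | h
    · exact Or.inl h
    · exact Or.inr (Or.inl h)
  · exact Or.inr (Or.inr (full_sound hr hq hp))

theorem mid_complete {X : List (Option S)} {l : {l : Pattern S // l.length ≤ N}} {z : List S}
    (h : X.reduceOption = l.1.input ++ z) : ∃ X' q, q ∈ (patternAutomaton R e N).accept ∧
      (patternAutomaton R e N).Run (State.mid l) X X' q ∧ X'.reduceOption = l.1.output ++ z := by
  induction X generalizing l z with
  | nil =>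
    obtain ⟨h1, rfl⟩ := List.append_eq_nil_iff.1 h.symm
    have hl : l.1 = [] := List.map_eq_nil_iff.1 h1
    exact ⟨[], State.mid l, Or.inr ⟨l, Or.inl rfl, hl⟩, RowAutomaton.Run.nil _,
      by simp [hl, Pattern.output]⟩
  | cons x X ih =>
    cases x with
    | none =>
      obtain ⟨X', q, hq, hr, h'⟩ := ih (l := l) (z := z) (by simpa using h)
      exact ⟨none :: X', q, hq, RowAutomaton.Run.cons Trans.midSkip hr, by simpa using h'⟩
    | some s =>
      rcases l with ⟨_ | ⟨⟨s', o⟩, l⟩, hl⟩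
      · simp only [Pattern.input, List.map_nil, List.nil_append,
          List.reduceOption_cons_of_some] at h
        subst h
        obtain ⟨X', q, hq, hr, h'⟩ := ih (l := ⟨[], hl⟩) (z := X.reduceOption) rfl
        exact ⟨some s :: X', q, hq, RowAutomaton.Run.cons (Trans.midDone rfl) hr,
          by simpa [Pattern.output] using h'⟩
      · simp only [Pattern.input, List.map_cons, List.cons_append,
          List.reduceOption_cons_of_some, List.cons.injEq] at h
        obtain ⟨rfl, h⟩ := h
        obtain ⟨X', q, hq, hr, h'⟩ := ih (l := ⟨l, by simp at hl; omega⟩) (z := z) h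
        refine ⟨o :: X', q, hq, RowAutomaton.Run.cons (Trans.midRead rfl) hr, ?_⟩
        cases o <;> simpa [Pattern.output] using h'

theorem full_complete {X : List (Option S)} {l : {l : Pattern S // l.length ≤ N}}
    (h : X.reduceOption = l.1.input) : ∃ X' q, q ∈ (patternAutomaton R e N).accept ∧
      (patternAutomaton R e N).Run (State.full l) X X' q ∧ X'.reduceOption = l.1.output := by
  induction X generalizing l with
  | nil =>
    have hl : l.1 = [] := List.map_eq_nil_iff.1 h.symm
    exact ⟨[], State.full l, Or.inr ⟨l, Or.inr rfl, hl⟩, RowAutomaton.Run.nil _,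
      by simp [hl, Pattern.output]⟩
  | cons x X ih =>
    cases x with
    | none =>
      obtain ⟨X', q, hq, hr, h'⟩ := ih (l := l) (by simpa using h)
      exact ⟨none :: X', q, hq, RowAutomaton.Run.cons Trans.fullSkip hr, by simpa using h'⟩
    | some s =>
      rcases l with ⟨_ | ⟨⟨s', o⟩, l⟩, hl⟩
      · simp [Pattern.input] at h
      · simp only [Pattern.input, List.map_cons, List.reduceOption_cons_of_some,
          List.cons.injEq] at h
        obtain ⟨rfl, h⟩ := h
        obtain ⟨X', q, hq, hr, h'⟩ := ih (l := ⟨l, by simp at hl; omega⟩) h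
        refine ⟨o :: X', q, hq, RowAutomaton.Run.cons (Trans.fullRead rfl) hr, ?_⟩
        cases o <;> simpa [Pattern.output] using h'

theorem copy_refl (X : List (Option S)) :
    (patternAutomaton R e N).Run State.copy X X State.copy := by
  induction X with
  | nil => exact RowAutomaton.Run.nil _
  | cons x X ih => exact RowAutomaton.Run.cons (Trans.copy x) ih

theorem step_refl (X : List (Option S)) : (patternAutomaton R e N).Step X X :=
  ⟨State.copy, Or.inl rfl, State.copy, Or.inl rfl, copy_refl X⟩

theorem copy_complete {X : List (Option S)} {l : Pattern S} (hl : l ∈ R) (hN : l.length ≤ N)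
    (h0 : l ≠ []) {p z : List S} (h : X.reduceOption = p ++ (l.input ++ z)) :
    ∃ X' q, q ∈ (patternAutomaton R e N).accept ∧
      (patternAutomaton R e N).Run State.copy X X' q ∧
        X'.reduceOption = p ++ (l.output ++ z) := by
  induction X generalizing p with
  | nil => simp [Pattern.input, h0] at h
  | cons x X ih =>
    cases x with
    | none =>
      obtain ⟨X', q, hq, hr, h'⟩ := ih (p := p) (by simpa using h)
      exact ⟨none :: X', q, hq, RowAutomaton.Run.cons (Trans.copy none) hr, by simpa using h'⟩
    | some s =>
      cases p with
      | cons s' p =>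
        simp only [List.cons_append, List.reduceOption_cons_of_some, List.cons.injEq] at h
        obtain ⟨rfl, h⟩ := h
        obtain ⟨X', q, hq, hr, h'⟩ := ih h
        exact ⟨some s :: X', q, hq, RowAutomaton.Run.cons (Trans.copy (some s)) hr,
          by simpa using h'⟩
      | nil =>
        rcases l with _ | ⟨⟨s', o⟩, l⟩
        · exact absurd rfl h0
        · simp only [Pattern.input, List.map_cons, List.cons_append, List.nil_append,
            List.reduceOption_cons_of_some, List.cons.injEq] at h
          obtain ⟨rfl, h⟩ := h
          obtain ⟨X', q, hq, hr, h'⟩ := mid_complete (R := R) (e := e) (N := N)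
            (l := ⟨l, by simp at hN; omega⟩) (z := z) h
          refine ⟨o :: X', q, hq, RowAutomaton.Run.cons (Trans.enter hl) hr, ?_⟩
          cases o <;> simpa [Pattern.output] using h'

theorem step_complete (hR : ∀ l ∈ R, l ≠ [] ∧ l.length ≤ N) (he : e.length ≤ N)
    {X : List (Option S)} {y : List S} (h : Rewrite R e X.reduceOption y) :
    ∃ X', (patternAutomaton R e N).Step X X' ∧ X'.reduceOption = y := by
  rcases h with rfl | ⟨l, hl, p, z, h1, rfl⟩ | ⟨h1, rfl⟩
  · exact ⟨X, step_refl X, rfl⟩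
  · obtain ⟨X', q, hq, hr, h⟩ := copy_complete (e := e) hl (hR l hl).2 (hR l hl).1 h1
    exact ⟨X', ⟨_, Or.inl rfl, q, hq, hr⟩, h⟩
  · obtain ⟨X', q, hq, hr, h⟩ := full_complete (R := R) (e := e) (l := ⟨e, he⟩) h1
    exact ⟨X', ⟨_, Or.inr ⟨_, rfl, rfl⟩, q, hq, hr⟩, h⟩

/-- Which steps are possible depends only on the nonblank symbols, so the positions of the blanks do
not matter. Rewriting erases or replaces symbols in place and never needs more room. -/
theorem blanks_iff (hR : ∀ l ∈ R, l ≠ [] ∧ l.length ≤ N) (he : e.length ≤ N)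
    {X : List (Option S)} : (patternAutomaton R e N).Blanks X ↔
      Relation.ReflTransGen (Rewrite R e) X.reduceOption [] := by
  have h0 : ∀ X : List (Option S), X.reduceOption = [] ↔ ∀ x ∈ X, x = none := by
    intro X
    rw [List.reduceOption_eq_nil_iff]
    constructor
    · rintro ⟨n, rfl⟩ x hx; exact List.eq_of_mem_replicate hx
    · intro h; exact ⟨_, List.eq_replicate_of_mem h⟩
  constructor
  · rintro ⟨n, h⟩
    induction n generalizing X with
    | zero => rw [(h0 X).2 h]
    | succ n ih =>
      obtain ⟨X', h1, h2⟩ := h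
      exact Relation.ReflTransGen.head (step_sound h1) (ih h2)
  · intro h
    generalize hx : X.reduceOption = x at h
    induction h using Relation.ReflTransGen.head_induction_on generalizing X with
    | refl => exact ⟨0, (h0 X).1 hx⟩
    | head h1 _ ih =>
      subst hx
      obtain ⟨X', h2, h3⟩ := step_complete hR he h1
      obtain ⟨n, hn⟩ := ih h3
      exact ⟨n + 1, X', h2, hn⟩

end Rewriting

/-! ### Grammar rules as patterns, and the theorem. -/

namespace ContextSensitiveRule

variable {T N : Type*} {S : Type}

/-- The pattern for the reversed application of a rule, with symbols coded by `f`. -/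
def pattern (r : ContextSensitiveRule T N) (f : Symbol T N → S) : Rewriting.Pattern S :=
  r.left.map (fun s => (f s, some (f s))) ++
    (f (r.output.head r.output_ne_nil), some (f (Symbol.nonterminal r.input))) ::
      r.output.tail.map (fun s => (f s, none)) ++ r.right.map (fun s => (f s, some (f s)))

theorem pattern_input (r : ContextSensitiveRule T N) (f : Symbol T N → S) :
    (r.pattern f).input = (r.left ++ r.output ++ r.right).map f := by
  have h : ∀ x : List (Symbol T N), (h0 : x ≠ []) → x.map f = f (x.head h0) :: x.tail.map f := by
    rintro (_ | ⟨s, x⟩) h0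
    · exact absurd rfl h0
    · rfl
  rw [List.map_append, List.map_append, h _ r.output_ne_nil]
  simp only [pattern, Rewriting.Pattern.input, List.map_append, List.map_cons, List.map_map,
    Function.comp_def]

theorem pattern_output (r : ContextSensitiveRule T N) (f : Symbol T N → S) :
    (r.pattern f).output = (r.left ++ [Symbol.nonterminal r.input] ++ r.right).map f := by
  have h1 : ∀ x : List (Symbol T N), (x.map fun s => some (f s)).reduceOption = x.map f := by
    intro x
    simp [List.reduceOption]
  simp [pattern, Rewriting.Pattern.output, Function.comp_def, List.reduceOption_append, h1]

end ContextSensitiveRule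

namespace ContextSensitiveGrammar

variable {T : Type*} (g : ContextSensitiveGrammar T) {S : Type}

/-- The patterns of the rules of a grammar. -/
def patterns (f : Symbol T g.NT → S) : Set (Rewriting.Pattern S) :=
  (fun r => r.pattern f) '' g.rules

/-- Rewriting runs derivations backwards. The start symbol is erased by the pattern for the whole
row, hence only when it stands alone. -/
theorem rewrite_map_iff (f : Symbol T g.NT ≃ S) {x y : List (Symbol T g.NT)} :
    Rewriting.Rewrite (g.patterns f) [(f (Symbol.nonterminal g.initial), none)] (x.map f) (y.map f) ↔
      x = y ∨ g.Produces y x ∨ x = [Symbol.nonterminal g.initial] ∧ y = [] := by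
  have hinj := List.map_injective_iff.2 f.injective
  have hsurj := List.map_surjective_iff.2 f.surjective
  refine or_congr hinj.eq_iff (or_congr ?_ (and_congr ?_ ?_))
  · constructor
    · rintro ⟨_, ⟨r, hr, rfl⟩, p, z, h1, h2⟩
      obtain ⟨p, rfl⟩ := hsurj p
      obtain ⟨z, rfl⟩ := hsurj z
      rw [r.pattern_input, ← List.map_append, ← List.map_append] at h1
      rw [r.pattern_output, ← List.map_append, ← List.map_append] at h2
      exact ⟨r, hr, p, z, by simpa using hinj h2, by simpa using hinj h1⟩
    · rintro ⟨r, hr, p, z, rfl, rfl⟩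
      refine ⟨_, ⟨r, hr, rfl⟩, p.map f, z.map f, ?_, ?_⟩
      · simp [r.pattern_input]
      · simp [r.pattern_output]
  · rw [← hinj.eq_iff]
    rfl
  · exact List.map_eq_nil_iff

theorem reflTransGen_rewrite_iff (f : Symbol T g.NT ≃ S) {x : List (Symbol T g.NT)} :
    Relation.ReflTransGen
      (Rewriting.Rewrite (g.patterns f) [(f (Symbol.nonterminal g.initial), none)]) (x.map f) [] ↔
      x = [] ∨ Relation.ReflTransGen g.Produces [Symbol.nonterminal g.initial] x := by
  constructor
  · intro h
    generalize hx : x.map f = z at h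
    induction h using Relation.ReflTransGen.head_induction_on generalizing x with
    | refl => exact Or.inl (List.map_eq_nil_iff.1 hx)
    | @head _ y h1 _ ih =>
      subst hx
      obtain ⟨y, rfl⟩ := List.map_surjective_iff.2 f.surjective y
      rcases (g.rewrite_map_iff f).1 h1 with rfl | h | ⟨rfl, rfl⟩
      · exact ih rfl
      · right
        -- The empty form produces nothing, as a rule needs a nonterminal.
        rcases ih rfl with rfl | h'
        · obtain ⟨r, _, p, q, h, -⟩ := h
          simp at h
        · exact h'.tail h
      · exact Or.inr Relation.ReflTransGen.refl
  · rintro (rfl | h)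
    · exact Relation.ReflTransGen.refl
    · induction h with
      | refl => exact Relation.ReflTransGen.single ((g.rewrite_map_iff f (y := [])).2
          (Or.inr (Or.inr ⟨rfl, rfl⟩)))
      | tail _ h ih => exact ih.head ((g.rewrite_map_iff f).2 (Or.inr (Or.inl h)))

end ContextSensitiveGrammar

/-- A language whose nonempty words form a context-sensitive language is the path language of a
rational graph of finite out-degree from a vertex to a regular language. -/
theorem Language.IsContextSensitive.exists_rationalGraph {α : Type*} [Finite α] {L : Language α}
    (h : Language.IsContextSensitive {w | w ∈ L ∧ w ≠ []}) :
    ∃ (Γ : Type) (_ : Finite Γ) (G : RationalGraph α Γ) (i : List Γ) (F : Language Γ),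
      G.FiniteOutDegree ∧ F.IsRegular ∧ G.pathLanguage {i} F = L := by
  obtain ⟨g, hg⟩ := h
  have := g.finite_NT
  have := Pipeline.finite_symbol (T := α) (N := g.NT)
  obtain ⟨n, ⟨f⟩⟩ := Finite.exists_equiv_fin (Symbol α g.NT)
  obtain ⟨N, hN⟩ : ∃ N, ∀ l ∈ g.patterns f, l.length ≤ N := by
    obtain ⟨N, hN⟩ := ((g.finite_rules.image fun r => r.pattern f).image List.length).bddAbove
    exact ⟨N, fun l hl => hN ⟨l, hl, rfl⟩⟩
  -- The bound `N + 1` also leaves room for the pattern of length 1 that erases the start symbol.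
  have hR : ∀ l ∈ g.patterns f, l ≠ [] ∧ l.length ≤ N + 1 := by
    refine fun l hl => ⟨?_, (hN l hl).trans (Nat.le_succ N)⟩
    obtain ⟨r, _, rfl⟩ := hl
    simp [ContextSensitiveRule.pattern]
  let A := Rewriting.patternAutomaton (g.patterns f) [(f (Symbol.nonterminal g.initial), none)] (N + 1)
  refine ⟨RowAutomaton.Letter A, RowAutomaton.finite_letter, RowAutomaton.tapeGraph A
    (Nat.card (Option (Fin n)) ^ 2) (fun a => f (Symbol.terminal a)),
    -- A vertex of ticks alone is final exactly when `[] ∈ L`; this settles the empty word and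
    -- affects no other.
    List.replicate (Nat.card (Option (Fin n)) ^ 2) .tick, A.finalVertices ([] ∈ L),
    RowAutomaton.tapeGraph_finiteOutDegree _, Language.isRegular_forall_mem _, ?_⟩
  ext w
  rw [RowAutomaton.tapeGraph_mem_pathLanguage (P := fun x => Relation.ReflTransGen
    (Rewriting.Rewrite (g.patterns f) [(f (Symbol.nonterminal g.initial), none)]) x [])
    Rewriting.step_refl (fun X => Rewriting.blanks_iff hR (by simp)) rfl]
  have key : w ≠ [] → (Relation.ReflTransGen (Rewriting.Rewrite (g.patterns f)
      [(f (Symbol.nonterminal g.initial), none)]) (w.map fun a => f (.terminal a)) [] ↔ w ∈ L) := by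
    intro hw
    have h1 := g.reflTransGen_rewrite_iff f (x := w.map Symbol.terminal)
    rw [List.map_map] at h1
    refine h1.trans ?_
    have h2 : w ∈ g.language ↔ w ∈ L ∧ w ≠ [] := by rw [hg]; rfl
    simp only [List.map_eq_nil_iff, hw, false_or]
    exact h2.trans (and_iff_left hw)
  by_cases hw : w = []
  · subst hw; simp
  · simp [hw, key hw]

theorem mainTheorem3 {α : Type*} [Finite α] (L : Language α) :
    (∃ (Γ : Type) (_ : Finite Γ) (G : RationalGraph α Γ) (i : List Γ) (F : Language Γ),
        G.FiniteOutDegree ∧ F.IsRegular ∧ G.pathLanguage {i} F = L) ↔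
      Language.IsContextSensitive {w | w ∈ L ∧ w ≠ []} := by
  constructor
  · rintro ⟨Γ, _, G, i, F, -, hF, rfl⟩
    exact G.isContextSensitive_pathLanguage i hF
  · exact Language.IsContextSensitive.exists_rationalGraph
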